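/- For $m\ge 1$ let $\Omega\mathbb{RP}^m$ be the space of continuous maps $\mathbb{RP}^1=\mathbb R\cup\{\infty\}\to\mathbb{RP}^m$ that send $\infty$ to $[1:\dots:1]$, with the compact-open topology. For $n\ge 0$ let $\mathrm{Rat}_n(\mathbb{RP}^m)\subseteq\Omega\mathbb{RP}^m$, with the subspace topology, be the closure of the set of all maps of the form $x\mapsto[p_0(x):\dots:p_m(x)]$, where $p_0,\dots,p_m$ are monic real polynomials of degree $n$ without a common root in $\mathbb C$. **Proposition.** For every integer $n>0$ the space $\mathrm{Rat}_n(\mathbb{RP}^2)$ is path-connected and, for every choice of base point, $$\pi_1\,\mathrm{Rat}_n(\mathbb{RP}^2)\cong\mathbb Z .$$ Moreover, if $n$ is odd, then $\mathrm{Rat}_1(\mathbb{RP}^2)\subseteq\mathrm{Rat}_n(\mathbb{RP}^2)$, and if $n$ is even, then $\mathrm{Rat}_2(\mathbb{RP}^2)\subseteq\mathrm{Rat}_n(\mathbb{RP}^2)$; in each case the inclusion induces an isomorphism of fundamental groups at every base point. -/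

import Mathlib

open Polynomial

namespace RationalLoops

/-- The real projective space `ℝP^m`: lines through the origin in `ℝ^(m+1)`. -/
def RP (m : ℕ) : Type := Projectivization ℝ (Fin (m + 1) → ℝ)

/-- `ℝP^m` carries the quotient topology from `ℝ^(m+1) \ {0}`. -/
instance (m : ℕ) : TopologicalSpace (RP m) :=
  inferInstanceAs (TopologicalSpace
    (Quotient (projectivizationSetoid ℝ (Fin (m + 1) → ℝ))))

/-- The point with homogeneous coordinates `[v 0 : ⋯ : v m]`. -/
noncomputable def RP.mk {m : ℕ} (v : Fin (m + 1) → ℝ) (hv : v ≠ 0) : RP m :=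
  Projectivization.mk ℝ v hv

/-- The point `[x : 1]` of the affine piece `ℝ ⊆ ℝP^1`. -/
noncomputable def affinePoint (x : ℝ) : RP 1 :=
  RP.mk ![x, 1] (fun h => one_ne_zero (congrFun h 1))

/-- The point `∞ = [1 : 0]`, the base point of `ℝP^1`. -/
noncomputable def infinity : RP 1 :=
  RP.mk ![1, 0] (fun h => one_ne_zero (congrFun h 0))

/-- The base point `[1 : 1 : ⋯ : 1]` of `ℝP^m`. -/
noncomputable def basePoint (m : ℕ) : RP m :=
  RP.mk (fun _ => 1) (fun h => one_ne_zero (congrFun h 0))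

/-- The loop space `Ω ℝP^m`: continuous maps `ℝP^1 → ℝP^m` sending `∞` to the base point,
with (the restriction of) the compact-open topology. -/
abbrev LoopRP (m : ℕ) : Type :=
  {f : C(RP 1, RP m) // f infinity = basePoint m}

/-- The based real rational maps of degree exactly `n`, restricted to the real axis and viewed
inside `Ω ℝP^m`: loops of the form `x ↦ [p 0 (x) : ⋯ : p m (x)]`, where `p 0, …, p m` are monic
real polynomials of degree `n` without a common root in `ℂ`. -/
def exactRat (n m : ℕ) : Set (LoopRP m) :=
  {f | ∃ p : Fin (m + 1) → ℝ[X],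
    (∀ i, (p i).Monic ∧ (p i).natDegree = n) ∧
    (∀ z : ℂ, ∃ i, aeval z (p i) ≠ 0) ∧
    ∀ x : ℝ, ∃ h : (fun i => (p i).eval x) ≠ 0,
      f.1 (affinePoint x) = RP.mk (fun i => (p i).eval x) h}

/-- The space `Rat_n(ℝP^m)` of real rational loops: the closure in `Ω ℝP^m` of the based real
rational maps of degree `n`.  As a type it has the subspace topology. -/
def rat (n m : ℕ) : Set (LoopRP m) :=
  closure (exactRat n m)

/-- The canonical inclusion `Rat_k(ℝP^m) → Rat_n(ℝP^m)`, when the first space is contained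
in the second. -/
def ratInclusion {k n m : ℕ} (h : rat k m ⊆ rat n m) : C(rat k m, rat n m) :=
  ⟨Set.inclusion h, continuous_inclusion h⟩

end RationalLoops

/-!
Loops in `Rat_n(ℝP^m)` can be replaced by tuples of real monic forms of degree `n` without a
common real zero. Indeed a limit of rational maps of degree `n` is a reduced rational map of some
degree `d ≤ n`; the inner product of its homogeneous form with that of a nearby map of degree `n`
has no zero on `ℝ² \ {0}`, and comparing its signs at `w` and `-w` gives `d ≡ n mod 2`, so
multiplication by a power of `X² + 1` lifts the limit to a tuple of degree `n`. Moreover the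
tuples whose loop is close to a given one form a convex set, and a continuous choice of such
tuples is a homotopy inverse to the map taking a tuple to its loop.

For `m = 2` the differences of the last two forms with the first one make up a single complex
polynomial `F` of degree `< n`, so a tuple is a pair `(p, F)` with `p` real monic and `F`
nonvanishing at the real zeros of `p`. Over a fixed `p` the space of such `F` is, up to homotopy,
the torus of the directions of `F` at the real zeros of `p`. Its fundamental group is generated by
the loops that turn simultaneously all the directions at zeros to the right of a point `b`. Moving
`p` deforms each of these loops into one fixed circle or into a constant loop, so `π₁` is cyclic.
Conversely, the sum of the arguments of `F` at the real zeros of `p`, each counted with the sign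
of the crossing of `p`, is continuous in `(p, F)` because zeros are created and destroyed in pairs
of opposite signs; it maps the circle to a generator of `π₁(S¹)`. Multiplication by `X² + 1`
preserves this invariant, whence the inclusions are isomorphisms on `π₁`.
-/

open CategoryTheory unitInterval Filter Topology

namespace RationalLoops

/-! ### Fundamental groups -/

section FundamentalGroup

variable {X Y Z : Type*} [TopologicalSpace X] [TopologicalSpace Y] [TopologicalSpace Z]

/-- The homotopy class of a path, as an arrow of the fundamental groupoid. -/
abbrev pathClass {x y : X} (γ : Path x y) : FundamentalGroupoid.mk x ⟶ FundamentalGroupoid.mk y :=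
  Path.Homotopic.Quotient.mk γ

theorem pathClass_eq_iff {x y : X} {γ γ' : Path x y} :
    pathClass γ = pathClass γ' ↔ γ.Homotopic γ' :=
  Path.Homotopic.Quotient.eq

theorem pathClass_surjective {x y : X} :
    Function.Surjective (pathClass : Path x y → _) :=
  Path.Homotopic.Quotient.mk_surjective

theorem pathClass_trans {x y z : X} (γ : Path x y) (γ' : Path y z) :
    pathClass (γ.trans γ') = pathClass γ ≫ pathClass γ' := rfl

theorem pathClass_subpath_comp {x y : X} (γ : Path x y) (r s t : I) :
    pathClass (γ.subpath r s) ≫ pathClass (γ.subpath s t) = pathClass (γ.subpath r t) :=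
  pathClass_eq_iff.2 ⟨Path.Homotopy.subpathTransSubpath γ r s t⟩

theorem pathClass_prod_comp_comm (μ : C(X × Y, Z)) {a b : X} {c d e : Y} (α : Path a b)
    (β : Path c d) (δ : Path d e) :
    pathClass (((Path.refl a).prod β).map μ.continuous) ≫ pathClass ((α.prod δ).map μ.continuous) =
      pathClass ((α.prod (Path.refl c)).map μ.continuous) ≫
        pathClass (((Path.refl b).prod (β.trans δ)).map μ.continuous) := by
  rw [← pathClass_trans, ← pathClass_trans, ← Path.map_trans, ← Path.map_trans,
    Path.trans_prod_eq_prod_trans, Path.trans_prod_eq_prod_trans]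
  exact pathClass_eq_iff.2 (.map ⟨Path.Homotopic.prodHomotopy
    ((Path.Homotopy.reflTrans α).trans (Path.Homotopy.transRefl α).symm)
    (Path.Homotopy.reflTrans _).symm⟩ μ)

theorem pathClass_symm {x y : X} (γ : Path x y) :
    pathClass γ.symm = Groupoid.inv (pathClass γ) := rfl

theorem fundamentalGroupMap_comp (g : C(Y, Z)) (f : C(X, Y)) (x : X) :
    FundamentalGroup.map (g.comp f) x =
      (FundamentalGroup.map g (f x)).comp (FundamentalGroup.map f x) := by
  ext q
  obtain ⟨γ, rfl⟩ := pathClass_surjective q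
  rfl

theorem bijective_map_end_of_iso {C D : Type*} [Category* C] [Category* D] (F : C ⥤ D) {x y : C}
    (α : x ≅ y) (hF : Function.Bijective fun f : x ⟶ x => F.map f) :
    Function.Bijective fun f : y ⟶ y => F.map f := by
  have hconj : (fun f : y ⟶ y => F.map f) ∘ α.conj =
      (F.mapIso α).conj ∘ fun f : x ⟶ x => F.map f :=
    funext fun f => F.map_conj α f
  rw [← Function.Bijective.of_comp_iff _ α.conj.bijective, hconj]
  exact (F.mapIso α).conj.bijective.comp hF

theorem bijective_fundamentalGroupMap_of_joined (f : C(X, Y)) {x y : X} (h : Joined x y)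
    (hf : Function.Bijective (FundamentalGroup.map f x)) :
    Function.Bijective (FundamentalGroup.map f y) :=
  bijective_map_end_of_iso (FundamentalGroupoid.map f) (asIso (pathClass h.somePath)) hf

theorem bijective_fundamentalGroupMap_homotopyEquiv (e : ContinuousMap.HomotopyEquiv X Y) (x : X) :
    Function.Bijective (FundamentalGroup.map e.toFun x) :=
  (FundamentalGroupoidFunctor.equivOfHomotopyEquiv e).fullyFaithfulFunctor.map_bijective
    (FundamentalGroupoid.mk x) (FundamentalGroupoid.mk x)

theorem pathClass_of_local
    {P : ∀ {y z : X}, (FundamentalGroupoid.mk y ⟶ FundamentalGroupoid.mk z) → Prop}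
    (hid : ∀ y : X, P (𝟙 (FundamentalGroupoid.mk y)))
    (hcomp : ∀ {y z w : X} (p : FundamentalGroupoid.mk y ⟶ FundamentalGroupoid.mk z)
      (q : FundamentalGroupoid.mk z ⟶ FundamentalGroupoid.mk w), P p → P q → P (p ≫ q))
    (hloc : ∀ x : X, ∃ U ∈ 𝓝 x, ∀ (y z : X) (γ : Path y z), (∀ t, γ t ∈ U) → P (pathClass γ))
    {y z : X} (γ : Path y z) : P (pathClass γ) := by
  choose U hU hP using hloc
  obtain ⟨t, ht0, hmono, ⟨N, hN⟩, hsub⟩ := exists_monotone_Icc_subset_open_cover_unitInterval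
    (c := fun x => γ ⁻¹' interior (U x)) (fun x => isOpen_interior.preimage γ.continuous)
    (fun s _ => Set.mem_iUnion.2 ⟨γ s, mem_interior_iff_mem_nhds.2 (hU (γ s))⟩)
  have hstep (k : ℕ) : P (pathClass (γ.subpath (t k) (t (k + 1)))) := by
    obtain ⟨x, hx⟩ := hsub k
    refine hP x _ _ _ fun s => ?_
    have hs := Set.mem_range_self (f := γ.subpath (t k) (t (k + 1))) s
    rw [Path.range_subpath_of_le _ _ _ (hmono k.le_succ)] at hs
    obtain ⟨r, hr, hrs⟩ := hs
    exact hrs ▸ interior_subset (hx hr)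
  have hinitial (k : ℕ) : P (pathClass (γ.subpath 0 (t k))) := by
    induction k with
    | zero => rw [ht0, Path.subpath_self]; exact hid _
    | succ k ih =>
      rw [← pathClass_subpath_comp γ 0 (t k)]
      exact hcomp _ _ ih (hstep k)
  have hfull := hinitial N
  rw [hN N le_rfl, Path.subpath_zero_one] at hfull
  obtain ⟨γ, rfl, rfl⟩ := γ
  exact hfull

theorem subgroup_eq_top_of_local {x₀ : X} (R : Subgroup (FundamentalGroup X x₀))
    (A : ∀ x : X, Set (FundamentalGroupoid.mk x₀ ⟶ FundamentalGroupoid.mk x))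
    (hne : ∀ x, (A x).Nonempty) (h₀ : 𝟙 _ ∈ A x₀)
    (hR : ∀ x, ∀ a ∈ A x, ∀ b ∈ A x, FundamentalGroup.fromArrow (a ≫ Groupoid.inv b) ∈ R)
    (hloc : ∀ x, ∃ U ∈ 𝓝 x, ∀ (y z : X) (γ : Path y z), (∀ t, γ t ∈ U) →
      ∃ a ∈ A y, a ≫ pathClass γ ∈ A z) : R = ⊤ := by
  have hmul {p q : FundamentalGroupoid.mk x₀ ⟶ FundamentalGroupoid.mk x₀}
      (hp : FundamentalGroup.fromArrow p ∈ R) (hq : FundamentalGroup.fromArrow q ∈ R) :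
      FundamentalGroup.fromArrow (p ≫ q) ∈ R := R.mul_mem hq hp
  have hclosed {y z : X} (γ : Path y z) : ∀ a ∈ A y, ∀ b ∈ A z,
      FundamentalGroup.fromArrow (a ≫ pathClass γ ≫ Groupoid.inv b) ∈ R := by
    refine pathClass_of_local (P := fun {y z} p => ∀ a ∈ A y, ∀ b ∈ A z,
      FundamentalGroup.fromArrow (a ≫ p ≫ Groupoid.inv b) ∈ R) ?_ ?_ ?_ γ
    · intro y a ha b hb
      simpa only [Category.id_comp] using hR y a ha b hb
    · intro y z w p q hp hq a ha b hb
      obtain ⟨c, hc⟩ := hne z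
      simpa using hmul (hp a ha c hc) (hq c hc b hb)
    · intro x
      obtain ⟨U, hU, h⟩ := hloc x
      refine ⟨U, hU, fun y z γ hγ a ha b hb => ?_⟩
      obtain ⟨c, hc, hcγ⟩ := h y z γ hγ
      simpa using hmul (hR y a ha c hc) (hR z _ hcγ b hb)
  refine (Subgroup.eq_top_iff' R).2 fun q => ?_
  obtain ⟨γ, rfl⟩ := pathClass_surjective q
  simpa using hclosed γ _ h₀ _ h₀

/-- Conjugation by an arrow of the fundamental groupoid, which moves the base point of a loop to
the source of the arrow. -/
noncomputable def conjHom {x₀ x : X} (β : FundamentalGroupoid.mk x₀ ⟶ FundamentalGroupoid.mk x) :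
    FundamentalGroup X x →* FundamentalGroup X x₀ :=
  (asIso β).symm.conj.toMonoidHom

theorem conjHom_apply {x₀ x : X} (β : FundamentalGroupoid.mk x₀ ⟶ FundamentalGroupoid.mk x)
    (q : FundamentalGroupoid.mk x ⟶ FundamentalGroupoid.mk x) :
    conjHom β q = β ≫ q ≫ Groupoid.inv β := by
  simp [conjHom, Iso.conj_apply]

theorem mapOfEq_pathClass (f : C(X, Y)) {x : X} {y : Y} (h : f x = y) (ℓ : Path x x) :
    FundamentalGroup.mapOfEq f h (pathClass ℓ) =
      pathClass ((ℓ.map f.continuous).cast h.symm h.symm) := by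
  subst h
  exact FundamentalGroup.mapOfEq_apply _ _ _

theorem mapOfEq_comp_apply (g : C(Y, Z)) (f : C(X, Y)) {x : X} {y : Y} {z : Z} (hf : f x = y)
    (hg : g y = z) (q : FundamentalGroup X x) :
    FundamentalGroup.mapOfEq (g.comp f) (y := z) (by simp [hf, hg]) q =
      FundamentalGroup.mapOfEq g hg (FundamentalGroup.mapOfEq f hf q) := by
  subst hf hg
  obtain ⟨γ, rfl⟩ := pathClass_surjective q
  simp only [mapOfEq_pathClass]
  rfl

theorem bijective_mapOfEq_iff (f : C(X, Y)) {x : X} {y : Y} (h : f x = y) :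
    Function.Bijective (FundamentalGroup.mapOfEq f h) ↔
      Function.Bijective (FundamentalGroup.map f x) :=
  Function.Bijective.of_comp_iff'
    (eqToIso (congrArg FundamentalGroupoid.mk h)).conj.bijective _

theorem conjHom_comp_apply {x₀ x y : X}
    (α : FundamentalGroupoid.mk x₀ ⟶ FundamentalGroupoid.mk x)
    (β : FundamentalGroupoid.mk x ⟶ FundamentalGroupoid.mk y) (q : FundamentalGroup X y) :
    conjHom (α ≫ β) q = conjHom α (conjHom β q) := by
  simp only [conjHom_apply, Groupoid.inv_eq_inv, IsIso.inv_comp, Category.assoc]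

theorem conjHom_id (x : X) : conjHom (𝟙 (FundamentalGroupoid.mk x)) = .id _ := by
  ext q
  exact (conjHom_apply _ _).trans (by simp)

theorem conjHom_mapOfEq_homotopy {f g : C(X, Y)} (F : f.Homotopy g) {x : X} {y z : Y}
    (hf : f x = y) (hg : g x = z) (q : FundamentalGroup X x) :
    conjHom (pathClass ((F.evalAt x).cast hf.symm hg.symm)) (FundamentalGroup.mapOfEq g hg q) =
      FundamentalGroup.mapOfEq f hf q := by
  subst hf hg
  obtain ⟨γ, rfl⟩ := pathClass_surjective q
  rw [mapOfEq_pathClass, mapOfEq_pathClass, conjHom_apply, ← Category.assoc, Groupoid.inv_eq_inv,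
    IsIso.comp_inv_eq]
  exact (pathClass_eq_iff.2 (Path.Homotopic.map_trans_evalAt F γ)).symm

end FundamentalGroup

section GroupLoops

variable {G ι : Type*} [TopologicalSpace G] [Group G]

theorem pathClass_eq_comp_of_mul [ContinuousMul G] {γ δ ε : Path (1 : G) 1}
    (h : ∀ t, ε t = γ t * δ t) : pathClass ε = pathClass γ ≫ pathClass δ := by
  have hγδ : ((γ.trans (Path.refl 1)).prod ((Path.refl 1).trans δ)).Homotopic (γ.prod δ) :=
    ⟨Path.Homotopic.prodHomotopy (.transRefl γ) (.reflTrans δ)⟩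
  have hmul := (hγδ.map ⟨fun q : G × G => q.1 * q.2, continuous_mul⟩).pathCast
    (mul_one 1).symm (mul_one 1).symm
  rw [← pathClass_trans, pathClass_eq_iff]
  convert hmul.symm using 1
  · ext t
    exact h t
  · ext t
    simp only [Path.trans_apply, Path.cast_coe, Path.map_coe, ContinuousMap.coe_mk,
      Function.comp_apply, Path.prod_coe]
    split_ifs <;> simp

/-- The loop in a power of a group which agrees with `γ` in the coordinates belonging to `P` and
is constant in the others. -/
noncomputable def indicatorLoop (P : Set ι) (γ : Path (1 : ι → G) 1) : Path (1 : ι → G) 1 where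
  toFun t := P.mulIndicator (γ t)
  continuous_toFun := by
    refine continuous_pi fun a => ?_
    by_cases ha : a ∈ P
    · exact ((continuous_apply a).comp γ.continuous).congr fun t =>
        (Set.mulIndicator_of_mem ha _).symm
    · simpa only [Set.mulIndicator_of_notMem ha] using continuous_const
  source' := by simp
  target' := by simp

theorem indicatorLoop_apply (P : Set ι) (γ : Path (1 : ι → G) 1) (t : I) :
    indicatorLoop P γ t = P.mulIndicator (γ t) := rfl

/-- The loop in a power of a group with all coordinates equal to a given loop. -/
def diagonalLoop (ℓ : Path (1 : G) 1) : Path (1 : ι → G) 1 :=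
  Path.pi fun _ => ℓ

theorem pathClass_indicatorLoop_union [ContinuousMul G] {P Q : Set ι} (h : Disjoint P Q)
    (γ : Path (1 : ι → G) 1) :
    pathClass (indicatorLoop (P ∪ Q) γ) =
      pathClass (indicatorLoop P γ) ≫ pathClass (indicatorLoop Q γ) :=
  pathClass_eq_comp_of_mul fun t => Set.mulIndicator_union_of_disjoint h (γ t)

theorem indicatorLoop_empty (γ : Path (1 : ι → G) 1) : indicatorLoop ∅ γ = Path.refl 1 := by
  ext t a
  simp [indicatorLoop_apply]

theorem indicatorLoop_univ (γ : Path (1 : ι → G) 1) : indicatorLoop Set.univ γ = γ := by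
  ext t a
  simp [indicatorLoop_apply]

theorem indicatorLoop_singleton (a : ι) (γ : Path (1 : ι → G) 1) :
    indicatorLoop {a} γ = indicatorLoop {a} (diagonalLoop (γ.map (continuous_apply a))) := by
  ext t b
  by_cases hb : b = a
  · subst hb
    simp [indicatorLoop_apply, diagonalLoop]
  · simp [indicatorLoop_apply, hb]

theorem exists_isolating_thresholds [Finite ι] {v : ι → ℝ} (hv : v.Injective) (a : ι) :
    ∃ b c : ℝ, b ∉ Set.range v ∧ c ∉ Set.range v ∧ {i | b < v i} = {a} ∪ {i | c < v i} ∧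
      v a < c := by
  have hlt : ∀ᶠ b in 𝓝[<] v a, b < v a ∧ ∀ i, v i < v a → v i < b :=
    (eventually_mem_nhdsWithin).and (eventually_all.2 fun i => eventually_imp_distrib_left.2
      fun hi => (eventually_gt_nhds hi).filter_mono nhdsWithin_le_nhds)
  have hgt : ∀ᶠ c in 𝓝[>] v a, v a < c ∧ ∀ i, v a < v i → c < v i :=
    (eventually_mem_nhdsWithin).and (eventually_all.2 fun i => eventually_imp_distrib_left.2
      fun hi => (eventually_lt_nhds hi).filter_mono nhdsWithin_le_nhds)
  obtain ⟨b, hba, hb⟩ := hlt.exists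
  obtain ⟨c, hac, hc⟩ := hgt.exists
  refine ⟨b, c, ?_, ?_, Set.ext fun i => ?_, hac⟩
  · rintro ⟨i, rfl⟩
    exact (hb i hba).false
  · rintro ⟨i, rfl⟩
    exact (hc i hac).false
  · rcases lt_trichotomy (v i) (v a) with h | h | h
    · have hia : i ≠ a := fun hia => by simp [hia] at h
      simp [hia, (hb i h).not_gt, (h.trans hac).not_gt]
    · simp [hv h, hba]
    · have hia : i ≠ a := fun hia => by simp [hia] at h
      simp [hia, hba.trans h, hc i h]

theorem subgroup_fundamentalGroup_pi_eq_top [ContinuousMul G] [Finite ι] {v : ι → ℝ}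
    (hv : v.Injective) (R : Subgroup (FundamentalGroup (ι → G) 1))
    (hR : ∀ b ∉ Set.range v, ∀ ℓ : Path (1 : G) 1, FundamentalGroup.fromArrow
      (pathClass (indicatorLoop {i | b < v i} (diagonalLoop ℓ))) ∈ R) : R = ⊤ := by
  have hmul {p q : FundamentalGroupoid.mk (1 : ι → G) ⟶ FundamentalGroupoid.mk 1}
      (hp : FundamentalGroup.fromArrow p ∈ R) (hq : FundamentalGroup.fromArrow q ∈ R) :
      FundamentalGroup.fromArrow (p ≫ q) ∈ R := R.mul_mem hq hp
  refine (Subgroup.eq_top_iff' R).2 fun q => ?_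
  obtain ⟨γ, rfl⟩ := pathClass_surjective q
  have hsingle (a : ι) : FundamentalGroup.fromArrow (pathClass (indicatorLoop {a} γ)) ∈ R := by
    obtain ⟨b, c, hb, hc, hbc, hac⟩ := exists_isolating_thresholds hv a
    have hunion := pathClass_indicatorLoop_union (P := {a}) (Q := {i | c < v i})
      (Set.disjoint_singleton_left.2 hac.not_gt) (diagonalLoop (γ.map (continuous_apply a)))
    rw [← hbc, ← indicatorLoop_singleton] at hunion
    rw [← IsIso.comp_inv_eq] at hunion
    rw [← hunion, ← Groupoid.inv_eq_inv]
    exact hmul (hR b hb _) (R.inv_mem (hR c hc _))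
  have hfinite (S : Set ι) (hS : S.Finite) :
      FundamentalGroup.fromArrow (pathClass (indicatorLoop S γ)) ∈ R := by
    induction S, hS using Set.Finite.induction_on with
    | empty =>
      rw [indicatorLoop_empty]
      exact R.one_mem
    | @insert a S ha _ ih =>
      rw [Set.insert_eq, pathClass_indicatorLoop_union (Set.disjoint_singleton_left.2 ha)]
      exact hmul (hsingle a) ih
  simpa only [indicatorLoop_univ] using hfinite Set.univ Set.finite_univ

end GroupLoops

section Circle

theorem nonempty_fundamentalGroup_circle_mulEquiv (z : Circle) :
    Nonempty (FundamentalGroup Circle z ≃* Multiplicative ℤ) := by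
  obtain ⟨x, hx⟩ := Circle.isAddQuotientCoveringMap_exp.surjective z
  have hinj : Function.Injective (zmultiplesHom ℝ (2 * Real.pi)) := fun m n h =>
    smul_left_injective ℤ Real.two_pi_pos.ne' h
  let deckEquiv := Circle.isAddQuotientCoveringMap_exp.fundamentalGroupEquiv (x := z) ⟨x, hx⟩
  let zmultiplesEquiv : ℤ ≃+ AddSubgroup.zmultiples (2 * Real.pi) :=
    (AddMonoidHom.ofInjective hinj).trans (AddEquiv.addSubgroupCongr
      (AddSubgroup.range_zmultiplesHom _))
  exact ⟨deckEquiv.trans (MulOpposite.opMulEquiv.symm.trans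
    (AddEquiv.toMultiplicative zmultiplesEquiv.symm))⟩

/-- The direction `z / ‖z‖` of a complex number `z`, with the junk value `1` at `z = 0`. -/
noncomputable def direction (z : ℂ) : Circle :=
  (z.arg : Real.Angle).toCircle

theorem norm_mul_direction (z : ℂ) : (‖z‖ : ℂ) * direction z = z := by
  rw [direction, Real.Angle.toCircle_coe, Circle.coe_exp, Complex.norm_mul_exp_arg_mul_I]

theorem direction_coe (z : Circle) : direction z = z :=
  Circle.ext (by simpa only [Circle.norm_coe, Complex.ofReal_one, one_mul] using
    norm_mul_direction z)

theorem continuous_angle_toCircle : Continuous Real.Angle.toCircle :=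
  continuous_coinduced_dom.2 Circle.exp.continuous

theorem continuousAt_direction {z : ℂ} (hz : z ≠ 0) : ContinuousAt direction z :=
  continuous_angle_toCircle.continuousAt.comp (Complex.continuousAt_arg_coe_angle hz)

end Circle

/-! ### Forms and their coefficients -/

section Forms

variable {n : ℕ} {M : Type*} [AddCommGroup M] [Module ℝ M]

/-- The value at `(u, v)` of the form of degree `n` with coefficients `c 0, …, c (n - 1)` and
vanishing coefficient of `u ^ n`: the homogenization of a polynomial of degree less than `n`. -/
def lowForm (c : Fin n → M) (u v : ℝ) : M :=
  ∑ i : Fin n, (u ^ (i : ℕ) * v ^ (n - (i : ℕ))) • c i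

/-- The value at `(u, v)` of the form of degree `n` with coefficients `a 0, …, a (n - 1), 1`: the
homogenization of a monic polynomial of degree `n`. -/
def monicForm (a : Fin n → ℝ) (u v : ℝ) : ℝ :=
  u ^ n + lowForm a u v

theorem lowForm_add (c d : Fin n → M) (u v : ℝ) :
    lowForm (c + d) u v = lowForm c u v + lowForm d u v := by
  simp only [lowForm, Pi.add_apply, smul_add, Finset.sum_add_distrib]

theorem lowForm_zero (u v : ℝ) : lowForm (0 : Fin n → M) u v = 0 := by
  simp only [lowForm, Pi.zero_apply, smul_zero, Finset.sum_const_zero]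

theorem lowForm_smul {S : Type*} [Monoid S] [DistribMulAction S M] [SMulCommClass ℝ S M] (s : S)
    (c : Fin n → M) (u v : ℝ) : lowForm (s • c) u v = s • lowForm c u v := by
  rw [lowForm, lowForm, Finset.smul_sum]
  exact Finset.sum_congr rfl fun i _ => smul_comm _ s _

theorem lowForm_ofReal (e : Fin n → ℝ) (u v : ℝ) :
    lowForm (fun i => (e i : ℂ)) u v = ((lowForm e u v : ℝ) : ℂ) := by
  simp [lowForm]

theorem monicForm_convexComb (a b : Fin n → ℝ) {s t : ℝ} (h : s + t = 1) (u v : ℝ) :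
    monicForm (s • a + t • b) u v = s * monicForm a u v + t * monicForm b u v := by
  simp only [monicForm, lowForm_add, lowForm_smul, smul_eq_mul]
  linear_combination (-u ^ n) * h

theorem lowForm_mul_mul (c : Fin n → M) (l u v : ℝ) :
    lowForm c (l * u) (l * v) = l ^ n • lowForm c u v := by
  rw [lowForm, lowForm, Finset.smul_sum]
  refine Finset.sum_congr rfl fun i _ => ?_
  rw [smul_smul, mul_pow, mul_pow, mul_mul_mul_comm, ← pow_add, Nat.add_sub_cancel' i.2.le]

theorem monicForm_mul_mul (a : Fin n → ℝ) (l u v : ℝ) :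
    monicForm a (l * u) (l * v) = l ^ n * monicForm a u v := by
  rw [monicForm, lowForm_mul_mul, monicForm, mul_pow, smul_eq_mul, mul_add]

theorem lowForm_infinity (c : Fin n → M) (u : ℝ) : lowForm c u 0 = 0 := by
  refine Finset.sum_eq_zero fun i _ => ?_
  rw [zero_pow (Nat.sub_ne_zero_of_lt i.2), mul_zero, zero_smul]

theorem monicForm_infinity (a : Fin n → ℝ) (u : ℝ) : monicForm a u 0 = u ^ n := by
  rw [monicForm, lowForm_infinity, add_zero]

@[fun_prop]
theorem continuous_lowForm [TopologicalSpace M] [ContinuousAdd M] [ContinuousSMul ℝ M] {X : Type*}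
    [TopologicalSpace X] {c : X → Fin n → M} {u v : X → ℝ} (hc : Continuous c)
    (hu : Continuous u) (hv : Continuous v) :
    Continuous fun x => lowForm (c x) (u x) (v x) := by
  unfold lowForm
  fun_prop

@[fun_prop]
theorem continuous_monicForm {X : Type*} [TopologicalSpace X] {a : X → Fin n → ℝ} {u v : X → ℝ}
    (ha : Continuous a) (hu : Continuous u) (hv : Continuous v) :
    Continuous fun x => monicForm (a x) (u x) (v x) := by
  unfold monicForm
  fun_prop

end Forms

section Polynomials

variable {n : ℕ} {A : Type*} [CommRing A]

/-- The vector of the first `n` coefficients of a polynomial. -/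
noncomputable def coef (n : ℕ) : A[X] →ₗ[A] (Fin n → A) :=
  LinearMap.pi fun i => lcoeff A i

theorem coef_apply (P : A[X]) (i : Fin n) : coef n P i = P.coeff i := rfl

theorem lowForm_coef [Algebra ℝ A] {P : A[X]} (hP : P.degree < n) (x : ℝ) :
    lowForm (coef n P) x 1 = P.eval (algebraMap ℝ A x) := by
  rcases eq_or_ne P 0 with rfl | h0
  · rw [map_zero, lowForm_zero, eval_zero]
  rw [eval_eq_sum_range' ((natDegree_lt_iff_degree_lt h0).2 hP), Finset.sum_range, lowForm]
  refine Finset.sum_congr rfl fun i _ => ?_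
  rw [one_pow, mul_one, Algebra.smul_def, map_pow, coef_apply, mul_comm]

theorem monicForm_coef {P : ℝ[X]} (hP : P.Monic) (hn : P.natDegree = n) (x : ℝ) :
    monicForm (coef n P) x 1 = P.eval x := by
  rw [eval_eq_sum_range, hn, Finset.sum_range_succ, Finset.sum_range, monicForm, lowForm,
    ← hn, hP.coeff_natDegree, hn, add_comm]
  simp [coef_apply, mul_comm]

/-- The polynomial of degree less than `n` with given coefficients. -/
noncomputable def lowPoly (c : Fin n → A) : A[X] :=
  ∑ i : Fin n, C (c i) * X ^ (i : ℕ)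

theorem degree_lowPoly (c : Fin n → A) : (lowPoly c).degree < n := by
  refine (degree_sum_le _ _).trans_lt ((Finset.sup_lt_iff (WithBot.bot_lt_coe n)).2 fun i _ => ?_)
  exact (degree_C_mul_X_pow_le _ _).trans_lt (Nat.cast_lt.2 i.2)

theorem coef_lowPoly (c : Fin n → A) : coef n (lowPoly c) = c := by
  ext i
  simp [coef_apply, lowPoly, coeff_X_pow, Fin.val_inj]

theorem lowForm_eq_eval [Algebra ℝ A] (c : Fin n → A) (x : ℝ) :
    lowForm c x 1 = (lowPoly c).eval (algebraMap ℝ A x) := by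
  rw [← lowForm_coef (degree_lowPoly c), coef_lowPoly]

/-- The monic polynomial of degree `n` with given lower coefficients. -/
noncomputable def monicPoly (a : Fin n → ℝ) : ℝ[X] :=
  X ^ n + lowPoly a

theorem monic_monicPoly (a : Fin n → ℝ) : (monicPoly a).Monic :=
  monic_X_pow_add (degree_lowPoly a)

theorem natDegree_monicPoly (a : Fin n → ℝ) : (monicPoly a).natDegree = n := by
  refine natDegree_eq_of_degree_eq_some ?_
  rw [monicPoly, degree_add_eq_left_of_degree_lt] <;> simp [degree_lowPoly a]

theorem monicForm_eq_eval (a : Fin n → ℝ) (x : ℝ) : monicForm a x 1 = (monicPoly a).eval x := by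
  rw [monicForm, lowForm_eq_eval, monicPoly, eval_add, eval_pow, eval_X,
    Algebra.algebraMap_self_apply]

end Polynomials

section RealZeros

variable {n : ℕ}

/-- The real zeros of the monic polynomial of degree `n` with lower coefficients `a`. -/
def realZeros (a : Fin n → ℝ) : Set ℝ :=
  {x | monicForm a x 1 = 0}

theorem mem_realZeros {a : Fin n → ℝ} {x : ℝ} : x ∈ realZeros a ↔ monicForm a x 1 = 0 := Iff.rfl

theorem realZeros_eq_roots (a : Fin n → ℝ) :
    realZeros a = ((monicPoly a).roots.toFinset : Set ℝ) := by
  ext x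
  simp [mem_realZeros, monicForm_eq_eval, (monic_monicPoly a).ne_zero]

theorem finite_realZeros (a : Fin n → ℝ) : (realZeros a).Finite :=
  realZeros_eq_roots a ▸ Finset.finite_toSet _

noncomputable instance (a : Fin n → ℝ) : Fintype (realZeros a) :=
  (finite_realZeros a).fintype

theorem ncard_realZeros_le (a : Fin n → ℝ) : (realZeros a).ncard ≤ n := by
  rw [realZeros_eq_roots, Set.ncard_coe_finset]
  exact (Multiset.toFinset_card_le _).trans
    ((card_roots' _).trans (natDegree_monicPoly a).le)

/-- The coefficients of the polynomial of degree less than `n` which takes given values at the real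
zeros of a monic polynomial of degree `n`. -/
noncomputable def interpolation {A : Type*} [Field A] [Algebra ℝ A] (a : Fin n → ℝ) :
    (realZeros a → A) →ₗ[A] (Fin n → A) :=
  (coef n).comp (Lagrange.interpolate Finset.univ fun i : realZeros a => algebraMap ℝ A i)

theorem lowForm_interpolation {A : Type*} [Field A] [Algebra ℝ A] (a : Fin n → ℝ)
    (w : realZeros a → A) (x : realZeros a) : lowForm (interpolation a w) x 1 = w x := by
  have hinj : Set.InjOn (fun i : realZeros a => algebraMap ℝ A i)
      (Finset.univ : Finset (realZeros a)) :=
    ((algebraMap ℝ A).injective.comp Subtype.val_injective).injOn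
  have hcard : (Finset.univ : Finset (realZeros a)).card ≤ n := by
    rw [Finset.card_univ, Set.fintypeCard_eq_ncard]
    exact ncard_realZeros_le a
  exact (lowForm_coef ((Lagrange.degree_interpolate_lt w hinj).trans_le
    (Nat.cast_le.2 hcard)) x).trans (Lagrange.eval_interpolate_at_node w hinj (Finset.mem_univ x))

end RealZeros

section Nonvanishing

variable {n : ℕ}

/-- Complex polynomials of degree less than `n` without zeros in a set of real numbers. -/
def nonvanishing (n : ℕ) (K : Set ℝ) : Set (Fin n → ℂ) :=
  {c | ∀ x ∈ K, lowForm c x 1 ≠ 0}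

theorem nonvanishing_anti {K L : Set ℝ} (h : K ⊆ L) : nonvanishing n L ⊆ nonvanishing n K :=
  fun _ hc x hx => hc x (h hx)

theorem exists_im_notMem_of_isRoot {P : ℂ[X]} (hP : P ≠ 0) :
    ∃ η > 0, ∀ z, P.IsRoot z → z.im ∉ Set.Ico (-η) 0 := by
  have hfinite : (Complex.im '' {z | P.IsRoot z} ∩ Set.Iio 0).Finite :=
    ((finite_setOfPred_isRoot hP).image Complex.im).subset Set.inter_subset_left
  have hevent : ∀ᶠ y in 𝓝 (0 : ℝ), y ∉ Complex.im '' {z | P.IsRoot z} ∩ Set.Iio 0 :=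
    hfinite.isClosed.isOpen_compl.mem_nhds fun h => lt_irrefl (0 : ℝ) h.2
  obtain ⟨ε, hε, hball⟩ := Metric.eventually_nhds_iff.1 hevent
  refine ⟨ε / 2, half_pos hε, fun z hz him => hball ?_ ⟨⟨z, hz, rfl⟩, him.2⟩⟩
  rw [Real.dist_eq, sub_zero, abs_of_neg him.2]
  linarith [him.1]

theorem exists_joinedIn_nonvanishing {K : Set ℝ} {c : Fin n → ℂ} (hc : c ∈ nonvanishing n K)
    (h0 : lowPoly c ≠ 0) :
    ∃ d ∈ nonvanishing n Set.univ, JoinedIn (nonvanishing n K) c d := by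
  obtain ⟨η, hη, hroot⟩ := exists_im_notMem_of_isRoot h0
  -- Translating the roots by `sηi`, `s > 0`, moves the real ones off the real line.
  let translate : ℝ → Fin n → ℂ := fun s => coef n (taylor (-(s * η * Complex.I)) (lowPoly c))
  have heval (s x : ℝ) :
      lowForm (translate s) x 1 = (lowPoly c).eval (x + -(s * η * Complex.I)) := by
    rw [lowForm_coef (by rw [degree_taylor]; exact degree_lowPoly c), taylor_eval]
    rfl
  have hcont : Continuous translate := by
    refine continuous_pi fun i => ?_
    simp only [translate, coef_apply, taylor_coeff]
    exact (Polynomial.continuous _).comp (by fun_prop)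
  have hne {s : ℝ} (x : ℝ) (h0 : 0 < s) (h1 : s ≤ 1) : lowForm (translate s) x 1 ≠ 0 := by
    rw [heval]
    refine fun h => hroot _ h ?_
    have him : ((x : ℂ) + -(s * η * Complex.I)).im = -(s * η) := by simp
    rw [him]
    exact ⟨neg_le_neg (mul_le_of_le_one_left hη.le h1), neg_neg_of_pos (mul_pos h0 hη)⟩
  have hzero : translate 0 = c := by simp [translate, coef_lowPoly]
  refine ⟨translate 1, fun x _ => hne x one_pos le_rfl,
    ⟨⟨⟨fun s : I => translate s, hcont.comp continuous_subtype_val⟩, hzero, rfl⟩, fun s x hx => ?_⟩⟩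
  rcases eq_or_lt_of_le s.2.1 with h | h
  · change lowForm (translate s) x 1 ≠ 0
    rw [← h, hzero]
    exact hc x hx
  · exact hne x h s.2.2

variable [NeZero n]

/-- The coefficients of the constant polynomial `1`, seen as a polynomial of degree less
than `n`. -/
def oneCoef (n : ℕ) [NeZero n] : Fin n → ℂ :=
  Pi.single 0 1

theorem lowForm_oneCoef (x : ℝ) : lowForm (oneCoef n) x 1 = 1 := by
  rw [lowForm, Finset.sum_eq_single 0 (fun i _ hi => by simp [oneCoef, hi]) (by simp)]
  simp [oneCoef]

theorem joinedIn_nonvanishing_smul_oneCoef {z : ℂ} (hz : z ≠ 0) :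
    JoinedIn (nonvanishing n Set.univ) (z • oneCoef n) (oneCoef n) := by
  have hjoined := ((isPathConnected_compl_singleton_of_one_lt_rank (E := ℂ)
    (by simp [Complex.rank_real_complex]) 0).joinedIn z hz 1 one_ne_zero).map
    (f := fun w : ℂ => w • oneCoef n) (by fun_prop)
  rw [one_smul] at hjoined
  refine hjoined.mono ?_
  rintro _ ⟨w, hw, rfl⟩ x -
  rwa [lowForm_smul, lowForm_oneCoef, smul_eq_mul, mul_one]

theorem joinedIn_nonvanishing_univ {c : Fin n → ℂ} (hc : c ∈ nonvanishing n Set.univ) :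
    JoinedIn (nonvanishing n Set.univ) c (oneCoef n) := by
  let dilate : ℝ → Fin n → ℂ := fun s i => s ^ (i : ℕ) • c i
  have hdilate (s x : ℝ) : lowForm (dilate s) x 1 = lowForm c (s * x) 1 := by
    refine Finset.sum_congr rfl fun i _ => ?_
    rw [smul_smul, one_pow, mul_one, mul_one, mul_pow, mul_comm]
  have hcont : Continuous dilate := by fun_prop
  have hzero : dilate 0 = c 0 • oneCoef n := by
    ext i
    by_cases hi : i = 0
    · simp [dilate, oneCoef, hi]
    · simp [dilate, oneCoef, hi, Fin.val_eq_zero_iff]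
  have hc0 : c 0 ≠ 0 := by
    have h := hdilate 0 0
    rw [hzero, lowForm_smul, lowForm_oneCoef, smul_eq_mul, mul_one, mul_zero] at h
    exact h ▸ hc 0 trivial
  refine .trans ⟨⟨⟨fun s : I => dilate (σ s), hcont.comp (by fun_prop)⟩, ?_, ?_⟩, fun s x _ => ?_⟩
    (joinedIn_nonvanishing_smul_oneCoef hc0)
  · simp [dilate]
  · simp [hzero]
  · change lowForm (dilate (σ s)) x 1 ≠ 0
    rw [hdilate]
    exact hc _ trivial

theorem joinedIn_nonvanishing {K : Set ℝ} {c : Fin n → ℂ} (hc : c ∈ nonvanishing n K) :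
    JoinedIn (nonvanishing n K) c (oneCoef n) := by
  rcases eq_or_ne (lowPoly c) 0 with h0 | h0
  · have hK : K = ∅ := Set.eq_empty_of_forall_notMem fun x hx => hc x hx (by
      rw [lowForm_eq_eval, h0, eval_zero])
    have huniv : nonvanishing n K = Set.univ := by simp [nonvanishing, hK]
    exact huniv ▸ joinedIn_univ.2 (PathConnectedSpace.joined _ _)
  · obtain ⟨d, hd, hcd⟩ := exists_joinedIn_nonvanishing hc h0
    exact hcd.trans ((joinedIn_nonvanishing_univ hd).mono (nonvanishing_anti (Set.subset_univ K)))

end Nonvanishing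

/-! ### Monic polynomials with a complex companion -/

section RatTuple

variable {n : ℕ}

/-- Pairs `(p, F)` of a monic real polynomial `p` of degree `n` and a complex polynomial `F` of
degree less than `n` without common real zeros. They encode the triples `(p, p + Re F, p + Im F)`
of monic real polynomials without common real zeros. -/
def ratTuple (n : ℕ) : Set ((Fin n → ℝ) × (Fin n → ℂ)) :=
  {x | x.2 ∈ nonvanishing n (realZeros x.1)}

/-- The inclusion into `ratTuple n` of the companions of a fixed monic polynomial. -/
def fiberInclusion (p : Fin n → ℝ) : C(nonvanishing n (realZeros p), ratTuple n) :=
  ⟨fun F => ⟨(p, F), F.2⟩, by fun_prop⟩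

/-- Pairs `(p, e)` of real polynomials for which `z ↦ (p, 1 + (z - 1) e)` is a circle in
`ratTuple n`. -/
def circleData (n : ℕ) : Set ((Fin n → ℝ) × (Fin n → ℝ)) :=
  {d | ∀ x, monicForm d.1 x 1 = 0 → lowForm d.2 x 1 ≠ 1 / 2}

theorem one_add_mul_ne_zero {z : Circle} {t : ℝ} (ht : t ≠ 1 / 2) :
    (1 : ℂ) + ((z : ℂ) - 1) * (t : ℂ) ≠ 0 := by
  intro h
  have heq : ((1 - t : ℝ) : ℂ) = -(z : ℂ) * (t : ℂ) := by push_cast; linear_combination h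
  have hnorm := congrArg norm heq
  rw [norm_mul, norm_neg, Circle.norm_coe, one_mul, Complex.norm_real, Complex.norm_real,
    Real.norm_eq_abs, Real.norm_eq_abs] at hnorm
  rcases abs_eq_abs.1 hnorm with h | h <;> apply ht <;> linarith

variable [NeZero n]

/-- The coefficients of `1 + (z - 1) e`. -/
def circleCoef (e : Fin n → ℝ) (z : Circle) : Fin n → ℂ :=
  oneCoef n + ((z : ℂ) - 1) • fun i => ((e i : ℝ) : ℂ)

theorem lowForm_circleCoef (e : Fin n → ℝ) (z : Circle) (x : ℝ) :
    lowForm (circleCoef e z) x 1 = 1 + ((z : ℂ) - 1) * (lowForm e x 1 : ℝ) := by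
  rw [circleCoef, lowForm_add, lowForm_oneCoef, lowForm_smul, lowForm_ofReal, smul_eq_mul]

theorem circleCoef_mem_nonvanishing (d : circleData n) (z : Circle) :
    circleCoef d.1.2 z ∈ nonvanishing n (realZeros d.1.1) := by
  intro x hx
  rw [lowForm_circleCoef]
  exact one_add_mul_ne_zero (d.2 x hx)

@[fun_prop]
theorem continuous_circleCoef {X : Type*} [TopologicalSpace X] {e : X → Fin n → ℝ}
    {z : X → Circle} (he : Continuous e) (hz : Continuous z) :
    Continuous fun x => circleCoef (e x) (z x) := by
  unfold circleCoef
  fun_prop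

theorem circleCoef_one (e : Fin n → ℝ) : circleCoef e 1 = oneCoef n := by
  simp [circleCoef]

theorem circleCoef_zero (z : Circle) : circleCoef (0 : Fin n → ℝ) z = oneCoef n := by
  ext i
  simp [circleCoef]

theorem oneCoef_mem_nonvanishing (K : Set ℝ) : oneCoef n ∈ nonvanishing n K := fun x _ => by
  rw [lowForm_oneCoef]
  exact one_ne_zero

/-- The constant companion `1` of a monic polynomial. -/
def fiberOne (p : Fin n → ℝ) : nonvanishing n (realZeros p) :=
  ⟨oneCoef n, oneCoef_mem_nonvanishing _⟩

/-- The contractible slice `F = 1` of `ratTuple n`. -/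
def baseSlice : C(Fin n → ℝ, ratTuple n) :=
  ⟨fun p => ⟨(p, oneCoef n), oneCoef_mem_nonvanishing _⟩, by fun_prop⟩

theorem fiberInclusion_fiberOne (p : Fin n → ℝ) : fiberInclusion p (fiberOne p) = baseSlice p := rfl

/-- The circle of companions of a monic polynomial determined by an element of `circleData n`. -/
noncomputable def fiberCircle (d : circleData n) : C(Circle, nonvanishing n (realZeros d.1.1)) :=
  ⟨fun z => ⟨circleCoef d.1.2 z, circleCoef_mem_nonvanishing d z⟩, by fun_prop⟩

/-- The circle in `ratTuple n` determined by an element of `circleData n`. -/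
noncomputable def circleMap (d : circleData n) : C(Circle, ratTuple n) :=
  (fiberInclusion d.1.1).comp (fiberCircle d)

theorem fiberCircle_one (d : circleData n) : fiberCircle d 1 = fiberOne d.1.1 :=
  Subtype.ext (circleCoef_one _)

theorem circleMap_one (d : circleData n) : circleMap d 1 = baseSlice d.1.1 := by
  rw [circleMap, ContinuousMap.comp_apply, fiberCircle_one, fiberInclusion_fiberOne]

theorem exists_path_baseSlice (x : ratTuple n) {K : Set ℝ} (hK : realZeros x.1.1 ⊆ K)
    (hx : x.1.2 ∈ nonvanishing n K) :
    ∃ γ : Path (baseSlice x.1.1) x, ∀ t, (γ t).1.1 = x.1.1 ∧ (γ t).1.2 ∈ nonvanishing n K := by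
  obtain ⟨γ, hγ⟩ := (joinedIn_nonvanishing hx).symm
  exact ⟨⟨⟨fun t => ⟨(x.1.1, γ t), nonvanishing_anti hK (hγ t)⟩, by fun_prop⟩,
    Subtype.ext (Prod.ext rfl γ.source), Subtype.ext (Prod.ext rfl γ.target)⟩,
    fun t => ⟨rfl, hγ t⟩⟩

instance pathConnectedSpace_ratTuple : PathConnectedSpace (ratTuple n) := by
  refine ⟨⟨baseSlice 0⟩, fun x y => ?_⟩
  obtain ⟨γ, -⟩ := exists_path_baseSlice x subset_rfl x.2
  obtain ⟨δ, -⟩ := exists_path_baseSlice y subset_rfl y.2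
  exact ⟨γ.symm.trans (((PathConnectedSpace.somePath x.1.1 y.1.1).map
    baseSlice.continuous).trans δ)⟩

end RatTuple

section CircleHom

variable {n : ℕ} [NeZero n]

/-- The class of the paths from `p` to `q` in the slice `F = 1`. -/
noncomputable def sliceArrow (p q : Fin n → ℝ) :
    FundamentalGroupoid.mk (baseSlice p) ⟶ FundamentalGroupoid.mk (baseSlice q) :=
  pathClass ((PathConnectedSpace.somePath p q).map baseSlice.continuous)

theorem pathClass_map_baseSlice {p q : Fin n → ℝ} (δ : Path p q) :
    pathClass (δ.map baseSlice.continuous) = sliceArrow p q :=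
  pathClass_eq_iff.2 ((SimplyConnectedSpace.paths_homotopic _ _).map baseSlice)

theorem sliceArrow_self (p : Fin n → ℝ) : sliceArrow p p = 𝟙 _ :=
  (pathClass_map_baseSlice (Path.refl p)).symm

theorem sliceArrow_comp (p q r : Fin n → ℝ) :
    sliceArrow p q ≫ sliceArrow q r = sliceArrow p r := by
  rw [sliceArrow, sliceArrow, ← pathClass_trans, ← Path.map_trans, pathClass_map_baseSlice]

/-- The homomorphism induced by the circle of `d`, with values transported along the slice `F = 1`
to a fundamental group which does not depend on `d`. -/
noncomputable def circleHom (p : Fin n → ℝ) (d : circleData n) :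
    FundamentalGroup Circle 1 →* FundamentalGroup (ratTuple n) (baseSlice p) :=
  (conjHom (sliceArrow p d.1.1)).comp (FundamentalGroup.mapOfEq (circleMap d) (circleMap_one d))

theorem circleHom_self (d : circleData n) :
    circleHom d.1.1 d = FundamentalGroup.mapOfEq (circleMap d) (circleMap_one d) := by
  rw [circleHom, sliceArrow_self, conjHom_id, MonoidHom.id_comp]

theorem circleHom_eq_of_joined (p : Fin n → ℝ) {d d' : circleData n} (h : Joined d d') :
    circleHom p d = circleHom p d' := by
  obtain ⟨δ⟩ := h
  let F : (circleMap d).Homotopy (circleMap d') :=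
    ⟨⟨fun s => circleMap (δ s.1) s.2, Continuous.subtype_mk (.prodMk (by fun_prop)
      (by simp only [fiberCircle, ContinuousMap.coe_mk]; fun_prop)) _⟩,
      fun z => by simp, fun z => by simp⟩
  have hslice : pathClass ((F.evalAt 1).cast (circleMap_one d).symm (circleMap_one d').symm) =
      sliceArrow d.1.1 d'.1.1 := by
    rw [← pathClass_map_baseSlice (δ.map (f := fun d => d.1.1) (by fun_prop))]
    exact congrArg pathClass (Path.ext (funext fun t => circleMap_one (δ t)))
  ext q
  rw [circleHom, circleHom, MonoidHom.comp_apply, MonoidHom.comp_apply,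
    ← sliceArrow_comp p d.1.1 d'.1.1, conjHom_comp_apply, ← hslice, conjHom_mapOfEq_homotopy]

theorem circleHom_eq_one (p : Fin n → ℝ) {d : circleData n} (hd : d.1.2 = 0) :
    circleHom p d = 1 := by
  ext q
  obtain ⟨ℓ, rfl⟩ := pathClass_surjective q
  have hconst : (ℓ.map (circleMap d).continuous).cast (circleMap_one d).symm
      (circleMap_one d).symm = Path.refl _ :=
    Path.ext (funext fun t => Subtype.ext (Prod.ext rfl
      ((congrArg (circleCoef · (ℓ t)) hd).trans (circleCoef_zero _))))
  rw [circleHom, MonoidHom.comp_apply, mapOfEq_pathClass, hconst]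
  exact map_one _

end CircleHom

section Fiber

variable {n : ℕ} (p : Fin n → ℝ)

/-- The directions of a companion of `p` at the real zeros of `p`. -/
noncomputable def fiberDirections : C(nonvanishing n (realZeros p), realZeros p → Circle) :=
  ⟨fun F x => direction (lowForm F.1 x 1), continuous_pi fun x =>
    continuous_iff_continuousAt.2 fun F => (continuousAt_direction (F.2 x x.2)).comp
      (f := fun F : nonvanishing n (realZeros p) => lowForm F.1 x 1) (by fun_prop)⟩

/-- The companion of `p` with given directions at the real zeros of `p`, obtained by
interpolation. -/
noncomputable def fiberOfDirections : C(realZeros p → Circle, nonvanishing n (realZeros p)) :=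
  ⟨fun z => ⟨interpolation p fun x => (z x : ℂ), fun x hx => by
    rw [lowForm_interpolation p _ ⟨x, hx⟩]
    exact Circle.coe_ne_zero _⟩,
    ((LinearMap.continuous_of_finiteDimensional _).comp (by fun_prop)).subtype_mk _⟩

theorem fiberDirections_comp_fiberOfDirections :
    (fiberDirections p).comp (fiberOfDirections p) = .id _ := by
  ext z x : 2
  exact (congrArg direction (lowForm_interpolation p _ x)).trans (direction_coe _)

theorem segment_direction_ne_zero {w : ℂ} (hw : w ≠ 0) (s : I) :
    ((σ s : ℝ) : ℂ) * direction w + ((s : ℝ) : ℂ) * w ≠ 0 := by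
  have heq : ((σ s : ℝ) : ℂ) * direction w + ((s : ℝ) : ℂ) * w =
      ((σ s + s * ‖w‖ : ℝ) : ℂ) * direction w := by
    push_cast
    linear_combination -(s : ℂ) * norm_mul_direction w
  rw [heq]
  refine mul_ne_zero (Complex.ofReal_ne_zero.2 (ne_of_gt ?_)) (Circle.coe_ne_zero _)
  rcases eq_or_lt_of_le s.2.1 with h | h
  · simp [← h]
  · have := (σ s).2.1
    positivity

theorem homotopic_fiberOfDirections_comp_fiberDirections :
    ((fiberOfDirections p).comp (fiberDirections p)).Homotopic (.id _) := by
  let segment (q : I × nonvanishing n (realZeros p)) : Fin n → ℂ :=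
    (σ q.1 : ℝ) • (fiberOfDirections p (fiberDirections p q.2)).1 + (q.1 : ℝ) • q.2.1
  have hmem (q) : segment q ∈ nonvanishing n (realZeros p) := by
    intro x hx
    have h := segment_direction_ne_zero (q.2.2 x hx) q.1
    rwa [lowForm_add, lowForm_smul, lowForm_smul, Complex.real_smul, Complex.real_smul,
      fiberOfDirections, ContinuousMap.coe_mk, lowForm_interpolation p _ ⟨x, hx⟩]
  have hcont : Continuous segment :=
    ((continuous_subtype_val.comp (continuous_symm.comp continuous_fst)).smul
      (continuous_subtype_val.comp (((fiberOfDirections p).comp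
        (fiberDirections p)).continuous.comp continuous_snd))).add (by fun_prop)
  exact ⟨⟨⟨fun q => ⟨segment q, hmem q⟩, hcont.subtype_mk _⟩, fun F => by simp [segment],
    fun F => by simp [segment]⟩⟩

/-- Evaluation at the zeros of `p` identifies the companions of `p` with a torus, up to homotopy. -/
noncomputable def fiberHomotopyEquiv :
    ContinuousMap.HomotopyEquiv (nonvanishing n (realZeros p)) (realZeros p → Circle) where
  toFun := fiberDirections p
  invFun := fiberOfDirections p
  left_inv := homotopic_fiberOfDirections_comp_fiberDirections p
  right_inv := by rw [fiberDirections_comp_fiberOfDirections]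

variable {p}

/-- At the real zeros of the monic polynomial `p`, the polynomial `e` is the step function which
jumps from `0` to `1` at `b`, for an element `(p, e)` of `circleData n`. -/
def IsStep (b : ℝ) (d : circleData n) : Prop :=
  b ∉ realZeros d.1.1 ∧ ∀ x ∈ realZeros d.1.1, lowForm d.1.2 x 1 = (Set.Ioi b).indicator 1 x

theorem exists_isStep (p : Fin n → ℝ) {b : ℝ} (hb : b ∉ realZeros p) :
    ∃ d : circleData n, d.1.1 = p ∧ IsStep b d := by
  have hstep (x) (hx : x ∈ realZeros p) :
      lowForm (interpolation p fun x => (Set.Ioi b).indicator (1 : ℝ → ℝ) x) x 1 =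
        (Set.Ioi b).indicator 1 x :=
    lowForm_interpolation p _ ⟨x, hx⟩
  refine ⟨⟨(p, _), fun x hx => ?_⟩, rfl, hb, hstep⟩
  rw [hstep x hx]
  by_cases h : b < x <;> simp [h]

variable [NeZero n]

theorem fiberDirections_fiberOne (p : Fin n → ℝ) :
    fiberDirections p (fiberOne p) = 1 :=
  funext fun x => (congrArg direction (lowForm_oneCoef x)).trans (direction_coe 1)

theorem mapOfEq_fiberDirections_fiberCircle {b : ℝ} {d : circleData n} (hd : IsStep b d)
    (ℓ : Path (1 : Circle) 1) :
    FundamentalGroup.mapOfEq (fiberDirections d.1.1) (fiberDirections_fiberOne d.1.1)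
        (FundamentalGroup.mapOfEq (fiberCircle d) (fiberCircle_one d) (pathClass ℓ)) =
      pathClass (indicatorLoop {x : realZeros d.1.1 | b < x} (diagonalLoop ℓ)) := by
  rw [mapOfEq_pathClass, mapOfEq_pathClass]
  refine congrArg pathClass (Path.ext (funext fun t => funext fun x => ?_))
  change direction (lowForm (circleCoef d.1.2 (ℓ t)) x 1) =
    Set.mulIndicator {x : realZeros d.1.1 | b < x} (fun _ => ℓ t) x
  rw [lowForm_circleCoef, hd.2 x x.2]
  by_cases h : b < x
  · simp [h, direction_coe]
  · simpa [h] using direction_coe 1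

theorem conjHom_mapOfEq_fiberInclusion_mem {p₀ p : Fin n → ℝ}
    {R : Subgroup (FundamentalGroup (ratTuple n) (baseSlice p₀))}
    (hR : ∀ b (d : circleData n), d.1.1 = p → IsStep b d → (circleHom p₀ d).range ≤ R)
    (q : FundamentalGroup (nonvanishing n (realZeros p)) (fiberOne p)) :
    conjHom (sliceArrow p₀ p)
      (FundamentalGroup.mapOfEq (fiberInclusion p) (fiberInclusion_fiberOne p) q) ∈ R := by
  let S := R.comap ((conjHom (sliceArrow p₀ p)).comp
    (FundamentalGroup.mapOfEq (fiberInclusion p) (fiberInclusion_fiberOne p)))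
  have hbijective :=
    (bijective_mapOfEq_iff (fiberDirections p) (fiberDirections_fiberOne p)).2
      (bijective_fundamentalGroupMap_homotopyEquiv (fiberHomotopyEquiv p) _)
  have htop := subgroup_fundamentalGroup_pi_eq_top (G := Circle) Subtype.val_injective
    (S.map (FundamentalGroup.mapOfEq (fiberDirections p) (fiberDirections_fiberOne p)))
    fun b hb ℓ => by
      rw [Subtype.range_coe] at hb
      obtain ⟨d, rfl, hd⟩ := exists_isStep p hb
      refine ⟨_, ?_, mapOfEq_fiberDirections_fiberCircle hd ℓ⟩
      have hcomp := mapOfEq_comp_apply (fiberInclusion d.1.1) (fiberCircle d) (fiberCircle_one d)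
        (fiberInclusion_fiberOne d.1.1) (pathClass ℓ)
      rw [SetLike.mem_coe, Subgroup.mem_comap, MonoidHom.comp_apply, ← hcomp]
      exact hR b d rfl hd ⟨pathClass ℓ, rfl⟩
  obtain ⟨q', hq', heq⟩ := Subgroup.eq_top_iff' _ |>.1 htop
    (FundamentalGroup.mapOfEq (fiberDirections p) (fiberDirections_fiberOne p) q)
  exact hbijective.1 heq ▸ hq'

end Fiber

/-! ### A circle generating the fundamental group -/

section Isolation

variable {n : ℕ}

theorem isOpen_setOf_forall_mem_compact {X Y : Type*} [TopologicalSpace X] [TopologicalSpace Y]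
    {K : Set Y} (hK : IsCompact K) {W : Set (X × Y)} (hW : IsOpen W) :
    IsOpen {x | ∀ y ∈ K, (x, y) ∈ W} :=
  isOpen_iff_eventually.2 fun _ hx =>
    hK.eventually_forall_of_forall_eventually fun y hy => hW.mem_nhds (hx y hy)

theorem isOpen_nonvanishing {K : Set ℝ} (hK : IsCompact K) : IsOpen (nonvanishing n K) :=
  isOpen_setOf_forall_mem_compact (X := Fin n → ℂ) (W := {q | lowForm q.1 q.2 1 ≠ 0}) hK
    (isOpen_ne_fun (by fun_prop) continuous_const)

theorem abs_lt_of_mem_realZeros {p : Fin n → ℝ} {x : ℝ} (hx : x ∈ realZeros p) :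
    |x| < ‖p‖ + 1 := by
  rw [mem_realZeros, monicForm_eq_eval] at hx
  have hbound := IsRoot.norm_lt_cauchyBound (monic_monicPoly p).ne_zero hx
  refine lt_of_lt_of_le (NNReal.coe_lt_coe.2 hbound) ?_
  rw [cauchyBound, (monic_monicPoly p).leadingCoeff, natDegree_monicPoly, nnnorm_one, div_one]
  push_cast
  gcongr
  refine NNReal.coe_le_coe.2 (Finset.sup_le fun i hi => ?_)
  have hcoeff : (monicPoly p).coeff i = p ⟨i, Finset.mem_range.1 hi⟩ := by
    rw [monicPoly, coeff_add, coeff_X_pow, if_neg (Finset.mem_range.1 hi).ne, zero_add]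
    exact congrFun (coef_lowPoly p) ⟨i, _⟩
  exact hcoeff ▸ nnnorm_le_pi_nnnorm p _

theorem eventually_realZeros_subset {p : Fin n → ℝ} {U : Set ℝ} (hU : IsOpen U)
    (h : realZeros p ⊆ U) : ∀ᶠ q in 𝓝 p, realZeros q ⊆ U := by
  have hbounded : ∀ᶠ q : Fin n → ℝ in 𝓝 p, ‖q‖ + 1 < ‖p‖ + 2 :=
    continuous_norm.add_const 1 |>.tendsto p |>.eventually_lt_const (by linarith)
  have hcompact : IsCompact (Metric.closedBall (0 : ℝ) (‖p‖ + 2) \ U) :=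
    (isCompact_closedBall _ _).diff hU
  have hnonzero : ∀ᶠ q in 𝓝 p, ∀ x ∈ Metric.closedBall (0 : ℝ) (‖p‖ + 2) \ U,
      monicForm q x 1 ≠ 0 :=
    (isOpen_setOf_forall_mem_compact (X := Fin n → ℝ) (W := {q | monicForm q.1 q.2 1 ≠ 0}) hcompact
      (isOpen_ne_fun (by fun_prop) continuous_const)).mem_nhds fun x hx hzero => hx.2 (h hzero)
  filter_upwards [hbounded, hnonzero] with q hq hne x hx
  by_contra hxU
  refine hne x ⟨?_, hxU⟩ hx
  rw [mem_closedBall_zero_iff, Real.norm_eq_abs]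
  exact ((abs_lt_of_mem_realZeros hx).trans hq).le

theorem exists_isolating_compact (x : ratTuple n) :
    ∃ K : Set ℝ, IsCompact K ∧ x.1.2 ∈ nonvanishing n K ∧ ∀ᶠ q in 𝓝 x.1.1, realZeros q ⊆ K := by
  have hopen : IsOpen {t : ℝ | lowForm x.1.2 t 1 ≠ 0} :=
    isOpen_ne_fun (by fun_prop) continuous_const
  have hzeros := finite_realZeros x.1.1
  obtain ⟨δ, hδ, hsub⟩ := hzeros.isCompact.exists_cthickening_subset_open hopen fun t ht => x.2 t ht
  refine ⟨Metric.cthickening δ (realZeros x.1.1), hzeros.isCompact.cthickening,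
    fun t ht => hsub ht, ?_⟩
  exact (eventually_realZeros_subset Metric.isOpen_thickening
    (Metric.self_subset_thickening hδ _)).mono fun q hq =>
      hq.trans (Metric.thickening_subset_cthickening _ _)

end Isolation

section Surjectivity

variable {n : ℕ} [NeZero n]

/-- The arrows to `x` of the fundamental groupoid of `ratTuple n` which are represented by a path
in the slice `F = 1` followed by a path in the fiber of `x`. -/
def fiberArrows (p₀ : Fin n → ℝ) (x : ratTuple n) :
    Set (FundamentalGroupoid.mk (baseSlice p₀) ⟶ FundamentalGroupoid.mk x) :=
  {a | ∃ γ : Path (baseSlice x.1.1) x,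
    (∀ t, (γ t).1.1 = x.1.1) ∧ a = sliceArrow p₀ x.1.1 ≫ pathClass γ}

theorem nonempty_fiberArrows (p₀ : Fin n → ℝ) (x : ratTuple n) : (fiberArrows p₀ x).Nonempty := by
  obtain ⟨γ, hγ⟩ := exists_path_baseSlice x subset_rfl x.2
  exact ⟨_, γ, fun t => (hγ t).1, rfl⟩

theorem id_mem_fiberArrows (p₀ : Fin n → ℝ) : 𝟙 _ ∈ fiberArrows p₀ (baseSlice p₀) :=
  ⟨Path.refl _, fun _ => rfl, ((Category.comp_id _).trans (sliceArrow_self p₀)).symm⟩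

theorem exists_mapOfEq_fiberInclusion_eq {p : Fin n → ℝ} (L : Path (baseSlice p) (baseSlice p))
    (hL : ∀ t, (L t).1.1 = p) :
    ∃ q, FundamentalGroup.mapOfEq (fiberInclusion p) (fiberInclusion_fiberOne p) q =
      pathClass L := by
  let ℓ : Path (fiberOne p) (fiberOne p) :=
    ⟨⟨fun t => ⟨(L t).1.2, fun x hx => (L t).2 x ((hL t).symm ▸ hx)⟩, by fun_prop⟩,
      Subtype.ext (congrArg (·.1.2) L.source), Subtype.ext (congrArg (·.1.2) L.target)⟩
  refine ⟨pathClass ℓ, (mapOfEq_pathClass _ _ _).trans (congrArg pathClass ?_)⟩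
  exact Path.ext (funext fun t => Subtype.ext (Prod.ext (hL t).symm rfl))

theorem exists_fiberArrow_comp_mem (p₀ : Fin n → ℝ) {O : Set (Fin n → ℝ)} {K : Set ℝ}
    (hOK : ∀ q ∈ O, realZeros q ⊆ K) {y z : ratTuple n} (γ : Path y z)
    (hO : ∀ t, (γ t).1.1 ∈ O) (hK : ∀ t, (γ t).1.2 ∈ nonvanishing n K) :
    ∃ a ∈ fiberArrows p₀ y, a ≫ pathClass γ ∈ fiberArrows p₀ z := by
  have hy := hO 0
  have hz := hO 1
  have hFy := hK 0
  have hFz := hK 1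
  rw [γ.source] at hy hFy
  rw [γ.target] at hz hFz
  let μ : C(O × nonvanishing n K, ratTuple n) :=
    ⟨fun q => ⟨(q.1, q.2), nonvanishing_anti (hOK _ q.1.2) q.2.2⟩, by fun_prop⟩
  let α : Path (⟨y.1.1, hy⟩ : O) ⟨z.1.1, hz⟩ :=
    ⟨⟨fun t => ⟨(γ t).1.1, hO t⟩, by fun_prop⟩, by simp, by simp⟩
  let δ : Path (⟨y.1.2, hFy⟩ : nonvanishing n K) ⟨z.1.2, hFz⟩ :=
    ⟨⟨fun t => ⟨(γ t).1.2, hK t⟩, by fun_prop⟩, by simp, by simp⟩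
  obtain ⟨β⟩ := (joinedIn_nonvanishing hFy).symm.joined_subtype
  let c : nonvanishing n K := ⟨oneCoef n, oneCoef_mem_nonvanishing K⟩
  have hslice : pathClass ((α.prod (Path.refl c)).map μ.continuous) = sliceArrow y.1.1 z.1.1 :=
    pathClass_map_baseSlice (α.map continuous_subtype_val)
  have hexchange := pathClass_prod_comp_comm μ α β δ
  rw [hslice] at hexchange
  refine ⟨_, ⟨((Path.refl ⟨y.1.1, hy⟩).prod β).map μ.continuous, fun _ => rfl, rfl⟩,
    ((Path.refl ⟨z.1.1, hz⟩).prod (β.trans δ)).map μ.continuous, fun _ => rfl, ?_⟩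
  rw [← sliceArrow_comp p₀ y.1.1 z.1.1, Category.assoc, Category.assoc]
  exact congrArg (sliceArrow p₀ y.1.1 ≫ ·) hexchange

theorem surjective_circleHom_self {d : circleData n}
    (hstep : ∀ b (d' : circleData n), IsStep b d' →
      (circleHom d.1.1 d').range ≤ (circleHom d.1.1 d).range) :
    Function.Surjective (circleHom d.1.1 d) := by
  refine MonoidHom.range_eq_top.1 (subgroup_eq_top_of_local _ (fiberArrows d.1.1)
    (nonempty_fiberArrows _) (id_mem_fiberArrows _) ?_ fun x => ?_)
  · rintro x _ ⟨γ, hγ, rfl⟩ _ ⟨δ, hδ, rfl⟩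
    obtain ⟨q, hq⟩ := exists_mapOfEq_fiberInclusion_eq (γ.trans δ.symm) fun t => by
      rw [Path.trans_apply]
      split_ifs
      · exact hγ _
      · exact hδ _
    have hmem := conjHom_mapOfEq_fiberInclusion_mem (p := x.1.1)
      (fun b d' _ hd' => hstep b d' hd') q
    rw [hq, conjHom_apply, pathClass_trans, pathClass_symm] at hmem
    simpa using hmem
  · obtain ⟨K, hK, hxK, hevent⟩ := exists_isolating_compact x
    refine ⟨{y | realZeros y.1.1 ⊆ K ∧ y.1.2 ∈ nonvanishing n K}, ?_, fun y z γ hγ =>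
      exists_fiberArrow_comp_mem _ (fun _ h => h) γ (fun t => (hγ t).1) fun t => (hγ t).2⟩
    exact ((continuous_fst.comp continuous_subtype_val).continuousAt.eventually hevent).and
      (((isOpen_nonvanishing hK).preimage (by fun_prop)).mem_nhds hxK)

end Surjectivity

section CircleData

variable {n : ℕ}

theorem convexComb_ne_zero {a b s : ℝ} (hab : 0 < a * b) (hs : s ∈ I) :
    (1 - s) * a + s * b ≠ 0 := by
  rcases pos_and_pos_or_neg_and_neg_of_mul_pos hab with ⟨ha, hb⟩ | ⟨ha, hb⟩
  · exact ((convex_Ioi (0 : ℝ)) ha hb (sub_nonneg.2 hs.2) hs.1 (by ring)).ne'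
  · exact ((convex_Iio (0 : ℝ)) ha hb (sub_nonneg.2 hs.2) hs.1 (by ring)).ne

theorem joinedIn_circleData_of_same_side {p e e' : Fin n → ℝ}
    (h : ∀ x ∈ realZeros p, 0 < (lowForm e x 1 - 1 / 2) * (lowForm e' x 1 - 1 / 2)) :
    JoinedIn (circleData n) (p, e) (p, e') := by
  refine JoinedIn.ofLine (f := fun s : ℝ => (p, (1 - s) • e + s • e')) (by fun_prop) (by simp)
    (by simp) ?_
  rintro _ ⟨s, hs, rfl⟩ x hx hhalf
  rw [lowForm_add, lowForm_smul, lowForm_smul, smul_eq_mul, smul_eq_mul] at hhalf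
  exact convexComb_ne_zero (h x hx) hs (by linear_combination hhalf)

theorem joinedIn_circleData_of_same_sign {p p' e : Fin n → ℝ}
    (h : ∀ x, lowForm e x 1 = 1 / 2 → 0 < monicForm p x 1 * monicForm p' x 1) :
    JoinedIn (circleData n) (p, e) (p', e) := by
  refine JoinedIn.ofLine (f := fun s : ℝ => ((1 - s) • p + s • p', e)) (by fun_prop) (by simp)
    (by simp) ?_
  rintro _ ⟨s, hs, rfl⟩ x hx hhalf
  rw [monicForm_convexComb _ _ (by ring)] at hx
  exact convexComb_ne_zero (h x hhalf) hs hx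

/-- The coefficients of `(x - b) ^ n + c`. -/
noncomputable def shiftedPow (n : ℕ) (b c : ℝ) : Fin n → ℝ :=
  coef n ((X - C b) ^ n + C c)

/-- The coefficients of the linear polynomial with value `1 / 2` and slope `1 / 2` at `b`. -/
noncomputable def halfLine (n : ℕ) (b : ℝ) : Fin n → ℝ :=
  coef n (C (1 / 2) * X + C ((1 - b) / 2))

theorem lowForm_halfLine (hn : 2 ≤ n) (b x : ℝ) :
    lowForm (halfLine n b) x 1 = 1 / 2 + (x - b) / 2 := by
  rw [halfLine, lowForm_coef (degree_linear_le.trans_lt (by exact_mod_cast hn))]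
  simp only [Algebra.algebraMap_self_apply, eval_add, eval_mul, eval_C, eval_X]
  ring

theorem joinedIn_halfLine (hn : 2 ≤ n) {b : ℝ} {d : circleData n} (hd : IsStep b d) :
    JoinedIn (circleData n) d.1 (d.1.1, halfLine n b) := by
  refine joinedIn_circleData_of_same_side fun x hx => ?_
  rw [hd.2 x hx, lowForm_halfLine hn]
  rcases lt_trichotomy b x with h | rfl | h
  · rw [Set.indicator_of_mem (Set.mem_Ioi.2 h), Pi.one_apply]
    linarith
  · exact absurd hx hd.1
  · rw [Set.indicator_of_notMem (Set.notMem_Ioi.2 h.le)]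
    linarith

variable [NeZero n]

theorem monicForm_shiftedPow (b c x : ℝ) :
    monicForm (shiftedPow n b c) x 1 = (x - b) ^ n + c := by
  have hdegree : (C c : ℝ[X]).degree < ((X - C b) ^ n : ℝ[X]).degree := by
    rw [degree_pow, degree_X_sub_C, nsmul_one]
    exact degree_C_le.trans_lt (Nat.cast_pos.2 (NeZero.pos n))
  rw [shiftedPow, monicForm_coef (((monic_X_sub_C b).pow n).add_of_left hdegree)
    (by rw [natDegree_add_C, natDegree_pow, natDegree_X_sub_C, mul_one])]
  simp

theorem lowForm_coef_one (x : ℝ) : lowForm (coef n (1 : ℝ[X])) x 1 = 1 := by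
  rw [lowForm_coef (degree_one_le.trans_lt (Nat.cast_pos.2 (NeZero.pos n))), eval_one]

theorem indicator_of_mem_realZeros_one {p : Fin 1 → ℝ} {b x : ℝ} (hx : x ∈ realZeros p) :
    (Set.Ioi b).indicator (1 : ℝ → ℝ) x = if monicForm p b 1 < 0 then 1 else 0 := by
  have hp (y : ℝ) : monicForm p y 1 = y + p 0 := by simp [monicForm, lowForm]
  rw [mem_realZeros, hp] at hx
  rw [Set.indicator_apply, hp]
  exact if_congr ⟨fun h => by linarith [Set.mem_Ioi.1 h], fun h => Set.mem_Ioi.2 (by linarith)⟩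
    rfl rfl

theorem exists_joinedIn_zero {b : ℝ} {d : circleData n} (hd : IsStep b d)
    (hb : 0 < monicForm d.1.1 b 1) : ∃ q, JoinedIn (circleData n) d.1 (q, 0) := by
  obtain rfl | hn := (Nat.one_le_iff_ne_zero.2 (NeZero.ne n)).eq_or_lt
  · refine ⟨d.1.1, joinedIn_circleData_of_same_side fun x hx => ?_⟩
    rw [hd.2 x hx, indicator_of_mem_realZeros_one hx, if_neg hb.not_gt, lowForm_zero]
    norm_num
  refine ⟨shiftedPow n b 1, (joinedIn_halfLine hn hd).trans
    ((joinedIn_circleData_of_same_sign (p' := shiftedPow n b 1) fun x hx => ?_).trans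
      (joinedIn_circleData_of_same_side fun x hx => ?_))⟩
  · rw [lowForm_halfLine hn] at hx
    obtain rfl : x = b := by linarith
    simpa [monicForm_shiftedPow, NeZero.ne n] using hb
  · rw [mem_realZeros, monicForm_shiftedPow] at hx
    rw [lowForm_halfLine hn, lowForm_zero]
    have hlt : x - b < 0 := by
      by_contra! h
      linarith [pow_nonneg h n]
    linarith

theorem exists_forall_joinedIn (n : ℕ) [NeZero n] :
    ∃ d₀, ∀ b (d : circleData n), IsStep b d → monicForm d.1.1 b 1 < 0 →
      JoinedIn (circleData n) d.1 d₀ := by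
  obtain rfl | hn := (Nat.one_le_iff_ne_zero.2 (NeZero.ne n)).eq_or_lt
  · refine ⟨(0, coef 1 1), fun b d hd hb => JoinedIn.trans
      (joinedIn_circleData_of_same_side (e' := coef 1 1) fun x hx => ?_)
      (joinedIn_circleData_of_same_sign fun x hx => ?_)⟩
    · rw [hd.2 x hx, indicator_of_mem_realZeros_one hx, if_pos hb, lowForm_coef_one]
      norm_num
    · rw [lowForm_coef_one] at hx
      norm_num at hx
  refine ⟨(shiftedPow n 0 (-1), halfLine n 0), fun b d hd hb => (joinedIn_halfLine hn hd).trans ?_⟩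
  refine (joinedIn_circleData_of_same_sign (p' := shiftedPow n 0 (-(|b| ^ n + 1)))
    fun x hx => ?_).trans ((joinedIn_circleData_of_same_side (e' := halfLine n 0)
      fun x hx => ?_).trans (joinedIn_circleData_of_same_sign fun x hx => ?_))
  · rw [lowForm_halfLine hn] at hx
    obtain rfl : x = b := by linarith
    refine mul_pos_of_neg_of_neg hb ?_
    rw [monicForm_shiftedPow, sub_zero]
    linarith [(le_abs_self _).trans_eq (abs_pow x n)]
  · rw [mem_realZeros, monicForm_shiftedPow, sub_zero] at hx
    have hpow : |b| ^ n < |x| ^ n := by linarith [(le_abs_self _).trans_eq (abs_pow x n)]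
    have hlt := lt_of_pow_lt_pow_left₀ n (abs_nonneg x) hpow
    rw [lowForm_halfLine hn, lowForm_halfLine hn]
    nlinarith [abs_mul_abs_self x, abs_nonneg b, (le_abs_self (b * x)).trans_eq (abs_mul b x)]
  · rw [lowForm_halfLine hn] at hx
    obtain rfl : x = 0 := by linarith
    rw [monicForm_shiftedPow, monicForm_shiftedPow, sub_zero, zero_pow (NeZero.ne n)]
    linarith [pow_nonneg (abs_nonneg b) n]

theorem surjective_circleHom_self_of_isStep {b : ℝ} {d : circleData n} (hd : IsStep b d)
    (hb : monicForm d.1.1 b 1 < 0) : Function.Surjective (circleHom d.1.1 d) := by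
  obtain ⟨d₀, hjoined⟩ := exists_forall_joinedIn n
  refine surjective_circleHom_self fun b' d' hd' => ?_
  rcases lt_or_gt_of_ne hd'.1 with hneg | hpos
  · exact (congrArg MonoidHom.range (circleHom_eq_of_joined _
      ((hjoined b' d' hd' hneg).trans (hjoined b d hd hb).symm).joined_subtype)).le
  · obtain ⟨q, hq⟩ := exists_joinedIn_zero hd' hpos
    rw [circleHom_eq_of_joined d.1.1 hq.joined_subtype, circleHom_eq_one _ rfl,
      MonoidHom.range_eq_bot_iff.2 rfl]
    exact bot_le

end CircleData

/-! ### Counting crossings with angles -/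

section Crossing

open Classical in
/-- `1` if `f` is eventually positive along `l`, and `0` otherwise. -/
noncomputable def eventualPositivity (f : ℝ → ℝ) (l : Filter ℝ) : ℤ :=
  if ∀ᶠ y in l, 0 < f y then 1 else 0

/-- The change of sign of `f` at `x`: `1` or `-1` if `f` becomes positive, respectively stops being
positive, at `x`, and `0` otherwise. -/
noncomputable def crossing (f : ℝ → ℝ) (x : ℝ) : ℤ :=
  eventualPositivity f (𝓝[>] x) - eventualPositivity f (𝓝[<] x)

variable {f : ℝ → ℝ}

open Classical in
theorem eventualPositivity_eq_ite {l : Filter ℝ} [l.NeBot] {P : Prop}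
    (h : ∀ᶠ y in l, 0 < f y ↔ P) : eventualPositivity f l = if P then 1 else 0 :=
  if_congr ((eventually_congr h).trans eventually_const) rfl rfl

open Classical in
theorem eventualPositivity_of_continuousAt {l : Filter ℝ} [l.NeBot] {x : ℝ} (hl : l ≤ 𝓝 x)
    (hf : ContinuousAt f x) (hx : f x ≠ 0) :
    eventualPositivity f l = if 0 < f x then 1 else 0 := by
  refine eventualPositivity_eq_ite (hl ?_)
  rcases lt_or_gt_of_ne hx with hneg | hpos
  · exact (hf.eventually_lt_const hneg).mono fun y hy => by simp only [hy.not_gt, hneg.not_gt]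
  · exact (hf.eventually_const_lt hpos).mono fun y hy => by simp only [hy, hpos]

theorem abs_crossing_le_one (f : ℝ → ℝ) (x : ℝ) : |crossing f x| ≤ 1 := by
  rw [crossing, eventualPositivity, eventualPositivity]
  split_ifs <;> simp

theorem crossing_mul_of_pos (f : ℝ → ℝ) {g : ℝ → ℝ} (hg : ∀ x, 0 < g x) :
    crossing (fun x => f x * g x) = crossing f := by
  have hpositivity (l) : eventualPositivity (fun x => f x * g x) l = eventualPositivity f l := by
    classical exact
      if_congr (eventually_congr (.of_forall fun y => mul_pos_iff_of_pos_right (hg y))) rfl rfl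
  ext x
  rw [crossing, hpositivity, hpositivity, crossing]

theorem pos_iff_pos_of_isPreconnected {s : Set ℝ} (hs : _root_.IsPreconnected s)
    (hf : ContinuousOn f s) (h0 : ∀ x ∈ s, f x ≠ 0) {x y : ℝ} (hx : x ∈ s) (hy : y ∈ s) :
    0 < f x ↔ 0 < f y := by
  wlog hpos : 0 < f x generalizing x y
  · exact ⟨fun h => absurd h hpos, fun h => (this hy hx h).1 h⟩
  refine iff_of_true hpos ?_
  by_contra! hle
  obtain ⟨z, hz, hzero⟩ := hs.intermediate_value hy hx hf ⟨hle, hpos.le⟩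
  exact h0 z hz hzero

theorem eventualPositivity_nhdsGT_eq_nhdsLT (hf : Continuous f) {a b : ℝ} (hab : a < b)
    (h0 : ∀ x ∈ Set.Ioo a b, f x ≠ 0) :
    eventualPositivity f (𝓝[>] a) = eventualPositivity f (𝓝[<] b) := by
  obtain ⟨c, hc⟩ := exists_between hab
  have hsign (y) (hy : y ∈ Set.Ioo a b) : 0 < f y ↔ 0 < f c :=
    pos_iff_pos_of_isPreconnected isPreconnected_Ioo hf.continuousOn h0 hy hc
  rw [eventualPositivity_eq_ite (mem_of_superset (Ioo_mem_nhdsGT hab) hsign),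
    eventualPositivity_eq_ite (mem_of_superset (Ioo_mem_nhdsLT hab) hsign)]

theorem sum_crossing (hf : Continuous f) {a b : ℝ} (hab : a < b) {S : Finset ℝ}
    (hS : ∀ x ∈ S, x ∈ Set.Ioo a b) (h0 : ∀ x ∈ Set.Ioo a b, f x = 0 → x ∈ S) :
    ∑ x ∈ S, crossing f x = eventualPositivity f (𝓝[<] b) - eventualPositivity f (𝓝[>] a) := by
  induction S using Finset.induction_on_max generalizing b with
  | empty =>
    rw [Finset.sum_empty, eventualPositivity_nhdsGT_eq_nhdsLT hf hab fun x hx hzero =>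
      Finset.notMem_empty _ (h0 x hx hzero), sub_self]
  | insert c S hmax ih =>
    have hc := hS c (Finset.mem_insert_self _ _)
    have hleft : ∑ x ∈ S, crossing f x =
        eventualPositivity f (𝓝[<] c) - eventualPositivity f (𝓝[>] a) :=
      ih hc.1 (fun x hx => ⟨(hS x (Finset.mem_insert_of_mem hx)).1, hmax x hx⟩) fun x hx hzero =>
        Finset.mem_of_mem_insert_of_ne (h0 x ⟨hx.1, hx.2.trans hc.2⟩ hzero) hx.2.ne
    have hright : eventualPositivity f (𝓝[>] c) = eventualPositivity f (𝓝[<] b) :=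
      eventualPositivity_nhdsGT_eq_nhdsLT hf hc.2 fun x hx hzero => by
        rcases Finset.mem_insert.1 (h0 x ⟨hc.1.trans hx.1, hx.2⟩ hzero) with rfl | hxS
        · exact hx.1.false
        · exact hx.1.not_gt (hmax x hxS)
    rw [Finset.sum_insert fun h => (hmax c h).false, hleft, crossing, hright]
    ring

end Crossing

section CrossingSum

theorem exists_closedBall_subset_pairwiseDisjoint {Z : Set ℝ} (hZ : Z.Finite) {W : ℝ → Set ℝ}
    (hW : ∀ t ∈ Z, W t ∈ 𝓝 t) :
    ∃ δ > 0, (∀ t ∈ Z, Metric.closedBall t δ ⊆ W t) ∧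
      Z.PairwiseDisjoint (Metric.closedBall · δ) := by
  obtain ⟨U, hU, hdisjoint⟩ := hZ.t2_separation
  have hball : ∀ᶠ δ in 𝓝[>] (0 : ℝ), ∀ t ∈ Z, Metric.closedBall t δ ⊆ W t ∩ U t :=
    ((eventually_all_finite hZ).2 fun t ht => eventually_closedBall_subset
      (inter_mem (hW t ht) ((hU t).2.mem_nhds (hU t).1))).filter_mono nhdsWithin_le_nhds
  obtain ⟨δ, hsub, hδ⟩ := (hball.and self_mem_nhdsWithin).exists
  exact ⟨δ, hδ, fun t ht => (hsub t ht).trans Set.inter_subset_left,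
    hdisjoint.mono_on fun t ht => (hsub t ht).trans Set.inter_subset_right⟩

variable {n : ℕ}

theorem eventually_ne_zero_and_pos_iff {p : Fin n → ℝ} {x : ℝ} (hx : x ∉ realZeros p) :
    ∀ᶠ q in 𝓝 p, x ∉ realZeros q ∧ (0 < monicForm q x 1 ↔ 0 < monicForm p x 1) := by
  have hcont : ContinuousAt (fun q : Fin n → ℝ => monicForm q x 1) p := by fun_prop
  rcases lt_or_gt_of_ne hx with hneg | hpos
  · exact (hcont.eventually_lt_const hneg).mono fun q hq =>
      ⟨hq.ne, by simp only [hq.not_gt, hneg.not_gt]⟩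
  · exact (hcont.eventually_const_lt hpos).mono fun q hq => ⟨hq.ne', by simp only [hq, hpos]⟩

open Classical in
theorem sum_crossing_Ioo {p : Fin n → ℝ} {a b : ℝ} (hab : a < b) (ha : a ∉ realZeros p)
    (hb : b ∉ realZeros p) :
    ∑ x ∈ (realZeros p).toFinset with x ∈ Set.Ioo a b, crossing (monicForm p · 1) x =
      (if 0 < monicForm p b 1 then 1 else 0) - if 0 < monicForm p a 1 then 1 else 0 := by
  have hcont : Continuous (monicForm p · 1) := by fun_prop
  rw [sum_crossing hcont hab (fun x hx => (Finset.mem_filter.1 hx).2) fun x hx hzero =>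
      Finset.mem_filter.2 ⟨Set.mem_toFinset.2 (mem_realZeros.2 hzero), hx⟩,
    eventualPositivity_of_continuousAt nhdsWithin_le_nhds hcont.continuousAt ha,
    eventualPositivity_of_continuousAt nhdsWithin_le_nhds hcont.continuousAt hb]

open Classical in
theorem eventually_sum_crossing_eq {p : Fin n → ℝ} {a t b : ℝ} (ha : a < t) (hb : t < b)
    (ht : realZeros p ∩ Set.Icc a b = {t}) :
    ∀ᶠ q in 𝓝 p, ∑ x ∈ (realZeros q).toFinset with x ∈ Set.Ioo a b, crossing (monicForm q · 1) x =
      crossing (monicForm p · 1) t := by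
  have hab := ha.trans hb
  have ha0 : a ∉ realZeros p := fun h => ha.ne (ht.subset ⟨h, Set.left_mem_Icc.2 hab.le⟩)
  have hb0 : b ∉ realZeros p := fun h => hb.ne' (ht.subset ⟨h, Set.right_mem_Icc.2 hab.le⟩)
  have hsingle : {x ∈ (realZeros p).toFinset | x ∈ Set.Ioo a b} = {t} := by
    ext x
    rw [Finset.mem_filter, Set.mem_toFinset, Finset.mem_singleton]
    refine ⟨fun h => ht.subset ⟨h.1, Set.Ioo_subset_Icc_self h.2⟩, ?_⟩
    rintro rfl
    exact ⟨(ht.symm.subset rfl).1, ha, hb⟩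
  filter_upwards [eventually_ne_zero_and_pos_iff ha0, eventually_ne_zero_and_pos_iff hb0]
    with q hqa hqb
  rw [sum_crossing_Ioo hab hqa.1 hqb.1, ← Finset.sum_singleton (crossing (monicForm p · 1)),
    ← hsingle, sum_crossing_Ioo hab ha0 hb0]
  simp only [hqa.2, hqb.2]

variable {G : Type*} [NormedAddCommGroup G]

/-- The sum of the values of `φ` at the real zeros of `p`, counted with the changes of sign of
`p`. -/
noncomputable def crossingSum (p : Fin n → ℝ) (φ : ℝ → G) : G :=
  ∑ x ∈ (realZeros p).toFinset, crossing (monicForm p · 1) x • φ x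

theorem norm_crossingSum_sub_le {p q : Fin n → ℝ} {φ ψ : ℝ → G} {τ : ℝ → ℝ} {ε : ℝ}
    (hmaps : Set.MapsTo τ (realZeros q) (realZeros p))
    (hcrossing : ∀ t ∈ realZeros p, ∑ x ∈ (realZeros q).toFinset with τ x = t,
      crossing (monicForm q · 1) x = crossing (monicForm p · 1) t)
    (hε : 0 ≤ ε) (hclose : ∀ x ∈ realZeros q, ‖ψ x - φ (τ x)‖ ≤ ε) :
    ‖crossingSum q ψ - crossingSum p φ‖ ≤ n * ε := by
  have hp : crossingSum p φ =
      ∑ x ∈ (realZeros q).toFinset, crossing (monicForm q · 1) x • φ (τ x) := by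
    rw [← Finset.sum_fiberwise_of_maps_to (t := (realZeros p).toFinset) (g := τ) fun x hx =>
      Set.mem_toFinset.2 (hmaps (Set.mem_toFinset.1 hx))]
    refine Finset.sum_congr rfl fun t ht => ?_
    rw [← hcrossing t (Set.mem_toFinset.1 ht), Finset.sum_smul]
    exact Finset.sum_congr rfl fun x hx => by rw [(Finset.mem_filter.1 hx).2]
  have hterm (x) (hx : x ∈ (realZeros q).toFinset) :
      ‖crossing (monicForm q · 1) x • (ψ x - φ (τ x))‖ ≤ ε := by
    have habs : ‖crossing (monicForm q · 1) x‖ ≤ 1 := by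
      rw [Int.norm_eq_abs]
      exact_mod_cast abs_crossing_le_one _ x
    refine (norm_zsmul_le _ _).trans ?_
    exact (mul_le_of_le_one_left (norm_nonneg _) habs).trans (hclose x (Set.mem_toFinset.1 hx))
  have hcard : ((realZeros q).toFinset.card : ℝ) ≤ n := by
    rw [← Set.ncard_eq_toFinset_card']
    exact_mod_cast ncard_realZeros_le q
  rw [hp, crossingSum, ← Finset.sum_sub_distrib]
  simp only [← smul_sub]
  refine (norm_sum_le_of_le _ hterm).trans ?_
  rw [Finset.sum_const, nsmul_eq_mul]
  exact mul_le_mul_of_nonneg_right hcard hε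

theorem eventually_exists_mapsTo_realZeros {p : Fin n → ℝ} {W : ℝ → Set ℝ}
    (hW : ∀ t ∈ realZeros p, W t ∈ 𝓝 t) :
    ∀ᶠ q in 𝓝 p, ∃ τ : ℝ → ℝ, Set.MapsTo τ (realZeros q) (realZeros p) ∧
      (∀ s ∈ realZeros q, s ∈ W (τ s)) ∧
      ∀ t ∈ realZeros p, ∑ x ∈ (realZeros q).toFinset with τ x = t,
        crossing (monicForm q · 1) x = crossing (monicForm p · 1) t := by
  obtain ⟨δ, hδ, hsub, hdisjoint⟩ :=
    exists_closedBall_subset_pairwiseDisjoint (finite_realZeros p) hW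
  have hunique {s t x : ℝ} (hs : s ∈ realZeros p) (ht : t ∈ realZeros p)
      (hxs : x ∈ Metric.closedBall s δ) (hxt : x ∈ Metric.closedBall t δ) : s = t :=
    hdisjoint.elim_set hs ht x hxs hxt
  have hisolated (t) (ht : t ∈ realZeros p) : realZeros p ∩ Set.Icc (t - δ) (t + δ) = {t} := by
    rw [← Real.closedBall_eq_Icc]
    have hself := Metric.mem_closedBall_self (x := t) hδ.le
    refine Set.Subset.antisymm (fun s hs => ?_) (Set.singleton_subset_iff.2 ⟨ht, hself⟩)
    exact hunique hs.1 ht (Metric.mem_closedBall_self hδ.le) hs.2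
  have hcover := eventually_realZeros_subset (U := ⋃ t ∈ realZeros p, Metric.ball t δ)
    (isOpen_biUnion fun _ _ => Metric.isOpen_ball) fun t ht =>
      Set.mem_biUnion ht (Metric.mem_ball_self hδ)
  have hcrossing := (eventually_all_finite (finite_realZeros p)).2 fun t ht =>
    eventually_sum_crossing_eq (sub_lt_self t hδ) (lt_add_of_pos_right t hδ) (hisolated t ht)
  filter_upwards [hcover, hcrossing] with q hcover hcrossing
  have hτ (s) (hs : s ∈ realZeros q) : ∃ t ∈ realZeros p, s ∈ Metric.ball t δ := by
    simpa only [Set.mem_iUnion, exists_prop] using hcover hs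
  choose! τ hτ hball using hτ
  have hclosed (s) (hs : s ∈ realZeros q) := Metric.ball_subset_closedBall (hball s hs)
  refine ⟨τ, hτ, fun s hs => hsub _ (hτ s hs) (hclosed s hs), fun t ht => ?_⟩
  rw [← hcrossing t ht]
  refine Finset.sum_congr (Finset.filter_congr fun s hs => ?_) fun _ _ => rfl
  rw [Set.mem_toFinset] at hs
  rw [← Real.ball_eq_Ioo]
  exact ⟨fun h => h ▸ hball s hs, fun h =>
    hunique (hτ s hs) ht (hclosed s hs) (Metric.ball_subset_closedBall h)⟩

theorem continuousAt_crossingSum {X : Type*} [TopologicalSpace X] {p : X → Fin n → ℝ}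
    {φ : X → ℝ → G} {x₀ : X} (hp : ContinuousAt p x₀)
    (hφ : ∀ t ∈ realZeros (p x₀), ContinuousAt (Function.uncurry φ) (x₀, t)) :
    ContinuousAt (fun x => crossingSum (p x) (φ x)) x₀ := by
  refine Metric.continuousAt_iff'.2 fun ε hε => ?_
  have hε' : 0 < ε / (n + 1) := by positivity
  have hclose (t) (ht : t ∈ realZeros (p x₀)) : ∃ W ∈ 𝓝 t, ∀ᶠ x in 𝓝 x₀, ∀ s ∈ W,
      ‖φ x s - φ x₀ t‖ ≤ ε / (n + 1) := by
    obtain ⟨V, hV, W, hW, hVW⟩ := mem_nhds_prod_iff.1 (Metric.continuousAt_iff'.1 (hφ t ht) _ hε')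
    refine ⟨W, hW, mem_of_superset hV fun x hx s hs => ?_⟩
    rw [← dist_eq_norm]
    exact (hVW (Set.mk_mem_prod hx hs)).le
  choose! W hW hclose using hclose
  filter_upwards [hp.eventually (eventually_exists_mapsTo_realZeros hW),
    (eventually_all_finite (finite_realZeros (p x₀))).2 hclose]
    with x ⟨τ, hτ, hτW, hcrossing⟩ hclose
  have hbound := norm_crossingSum_sub_le hτ hcrossing hε'.le
    fun s hs => hclose _ (hτ hs) s (hτW s hs)
  rw [dist_eq_norm]
  refine hbound.trans_lt ?_
  rw [← mul_div_assoc, div_lt_iff₀ (by positivity)]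
  linarith

end CrossingSum

section CrossingCircle

variable {n : ℕ}

theorem crossingSum_congr {G : Type*} [NormedAddCommGroup G] {p : Fin n → ℝ} {φ ψ : ℝ → G}
    (h : ∀ x ∈ realZeros p, φ x = ψ x) : crossingSum p φ = crossingSum p ψ :=
  Finset.sum_congr rfl fun x hx => by rw [h x (Set.mem_toFinset.1 hx)]

/-- The sum of the angles of `F` at the real zeros of `p`, counted with the changes of sign of
`p`. -/
noncomputable def crossingAngle (x : (Fin n → ℝ) × (Fin n → ℂ)) : Real.Angle :=
  crossingSum x.1 fun t => (lowForm x.2 t 1).arg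

theorem crossingAngle_eq_of_pos_mul {k : ℕ} {x : (Fin n → ℝ) × (Fin n → ℂ)}
    {y : (Fin k → ℝ) × (Fin k → ℂ)} {q : ℝ → ℝ} (hq : ∀ t, 0 < q t)
    (hp : ∀ t, monicForm y.1 t 1 = monicForm x.1 t 1 * q t)
    (hF : ∀ t, lowForm y.2 t 1 = q t * lowForm x.2 t 1) :
    crossingAngle y = crossingAngle x := by
  have hzeros : realZeros y.1 = realZeros x.1 := by
    ext t
    rw [mem_realZeros, mem_realZeros, hp, mul_eq_zero_iff_right (hq t).ne']
  rw [crossingAngle, crossingAngle, crossingSum, crossingSum]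
  simp only [hp, hF, crossing_mul_of_pos _ hq, Complex.arg_real_mul _ (hq _)]
  exact Finset.sum_congr (Set.toFinset_congr hzeros) fun _ _ => rfl

theorem continuousAt_crossingAngle {x : (Fin n → ℝ) × (Fin n → ℂ)} (hx : x ∈ ratTuple n) :
    ContinuousAt crossingAngle x := by
  refine continuousAt_crossingSum continuousAt_fst fun t ht => ?_
  refine (Complex.continuousAt_arg_coe_angle (hx t ht)).comp
    (f := fun y : ((Fin n → ℝ) × (Fin n → ℂ)) × ℝ => lowForm y.1.2 y.2 1) (x := (x, t)) ?_
  fun_prop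

/-- The map to the circle which identifies the fundamental group of `ratTuple n` with `ℤ`. -/
noncomputable def crossingCircle (n : ℕ) : C(ratTuple n, Circle) :=
  ⟨fun x => (crossingAngle x.1).toCircle, continuous_angle_toCircle.comp
    (continuous_iff_continuousAt.2 fun x =>
      (continuousAt_crossingAngle x.2).comp continuousAt_subtype_val)⟩

variable [NeZero n]

theorem exists_gt_monicForm_pos (p : Fin n → ℝ) (b : ℝ) : ∃ M > b, 0 < monicForm p M 1 := by
  have hlim : Tendsto (monicForm p · 1) atTop atTop := by
    simp only [monicForm_eq_eval]
    refine tendsto_atTop_of_leadingCoeff_nonneg _ ?_ ?_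
    · rw [degree_eq_natDegree (monic_monicPoly p).ne_zero, natDegree_monicPoly]
      exact_mod_cast NeZero.pos n
    · rw [(monic_monicPoly p).leadingCoeff]
      exact zero_le_one
  exact ((eventually_gt_atTop b).and (hlim.eventually_gt_atTop 0)).exists

theorem crossingSum_indicator {G : Type*} [NormedAddCommGroup G] {p : Fin n → ℝ} {b : ℝ}
    (hb : monicForm p b 1 < 0) (a : G) :
    crossingSum p ((Set.Ioi b).indicator fun _ => a) = a := by
  classical
  obtain ⟨M, hM, hpos⟩ := exists_gt_monicForm_pos p (max b (‖p‖ + 1))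
  rw [gt_iff_lt, max_lt_iff] at hM
  have hfilter : {x ∈ (realZeros p).toFinset | x ∈ Set.Ioi b} =
      {x ∈ (realZeros p).toFinset | x ∈ Set.Ioo b M} :=
    Finset.filter_congr fun x hx => (and_iff_left ((le_abs_self x).trans_lt
      ((abs_lt_of_mem_realZeros (Set.mem_toFinset.1 hx)).trans hM.2))).symm
  have hcrossing := sum_crossing_Ioo hM.1 hb.ne hpos.ne'
  rw [if_pos hpos, if_neg hb.not_gt, sub_zero] at hcrossing
  simp only [crossingSum, Set.indicator_apply, smul_ite, smul_zero]
  rw [← Finset.sum_filter, ← Finset.sum_smul, hfilter, hcrossing, one_smul]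

theorem crossingCircle_comp_circleMap {b : ℝ} {d : circleData n} (hd : IsStep b d)
    (hb : monicForm d.1.1 b 1 < 0) : (crossingCircle n).comp (circleMap d) = .id _ := by
  ext1 z
  have hangle : crossingAngle (d.1.1, circleCoef d.1.2 z) = ((z : ℂ).arg : Real.Angle) := by
    rw [crossingAngle, ← crossingSum_indicator hb ((z : ℂ).arg : Real.Angle)]
    refine crossingSum_congr fun x hx => ?_
    rw [lowForm_circleCoef, hd.2 x hx]
    by_cases h : b < x <;> simp [h]
  exact (congrArg Real.Angle.toCircle hangle).trans (direction_coe z)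

theorem bijective_map_crossingCircle (x : ratTuple n) :
    Function.Bijective (FundamentalGroup.map (crossingCircle n) x) := by
  have hneg : monicForm (shiftedPow n 0 (-1)) 0 1 < 0 := by
    rw [monicForm_shiftedPow, sub_zero, zero_pow (NeZero.ne n)]
    norm_num
  obtain ⟨d, hp, hd⟩ := exists_isStep (shiftedPow n 0 (-1)) hneg.ne
  rw [← hp] at hneg
  have hone : crossingCircle n (baseSlice d.1.1) = 1 := by
    rw [← circleMap_one]
    exact DFunLike.congr_fun (crossingCircle_comp_circleMap hd hneg) 1
  have hinverse : Function.LeftInverse (FundamentalGroup.mapOfEq (crossingCircle n) hone)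
      (circleHom d.1.1 d) := fun q => by
    rw [circleHom_self, ← mapOfEq_comp_apply]
    obtain ⟨ℓ, rfl⟩ := pathClass_surjective q
    rw [mapOfEq_pathClass]
    exact congrArg pathClass (Path.ext (funext fun t =>
      DFunLike.congr_fun (crossingCircle_comp_circleMap hd hneg) (ℓ t)))
  have hbijective : Function.Bijective (circleHom d.1.1 d) :=
    ⟨hinverse.injective, surjective_circleHom_self_of_isStep hd hneg⟩
  have hcrossing : Function.Bijective (FundamentalGroup.mapOfEq (crossingCircle n) hone) :=
    (Function.Bijective.of_comp_iff _ hbijective).1 (hinverse.comp_eq_id ▸ Function.bijective_id)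
  exact bijective_fundamentalGroupMap_of_joined _ (PathConnectedSpace.joined _ x)
    ((bijective_mapOfEq_iff _ hone).1 hcrossing)

end CrossingCircle

/-! ### Projective space as a space of lines -/

section ProjectiveSpace

variable {m : ℕ}

/-- The line spanned by a nonzero vector; the vectors are taken in Euclidean space to have the
inner product at hand. -/
noncomputable def RP.line (v : EuclideanSpace ℝ (Fin (m + 1))) (hv : v ≠ 0) : RP m :=
  RP.mk v.ofLp ((WithLp.ofLp_eq_zero 2).not.2 hv)

theorem RP.exists_line_eq (ℓ : RP m) : ∃ v, ∃ hv : v ≠ 0, RP.line v hv = ℓ :=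
  ⟨WithLp.toLp 2 (Projectivization.rep ℓ),
    (WithLp.toLp_eq_zero 2).not.2 (Projectivization.rep_nonzero ℓ), Projectivization.mk_rep ℓ⟩

theorem RP.line_eq_line_iff {v w : EuclideanSpace ℝ (Fin (m + 1))} {hv : v ≠ 0} {hw : w ≠ 0} :
    RP.line v hv = RP.line w hw ↔ ∃ c : ℝ, c • w = v := by
  refine (Projectivization.mk_eq_mk_iff' ℝ v.ofLp w.ofLp _ _).trans (exists_congr fun c => ?_)
  exact ⟨fun h => WithLp.ofLp_injective 2 h, congrArg WithLp.ofLp⟩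

theorem RP.line_eq_line_iff_norm_smul {v w : EuclideanSpace ℝ (Fin (m + 1))}
    {hv : v ≠ 0} {hw : w ≠ 0} :
    RP.line v hv = RP.line w hw ↔ ‖w‖ ^ 2 • v = inner ℝ w v • w := by
  have hw' : ‖w‖ ^ 2 ≠ 0 := pow_ne_zero 2 (norm_ne_zero_iff.2 hw)
  rw [RP.line_eq_line_iff]
  constructor
  · rintro ⟨c, rfl⟩
    rw [inner_smul_right, real_inner_self_eq_norm_sq, smul_smul, mul_comm]
  · intro h
    exact ⟨inner ℝ w v / ‖w‖ ^ 2, by rw [div_eq_inv_mul, mul_smul, ← h, inv_smul_smul₀ hw']⟩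

theorem RP.isOpenQuotientMap_line :
    IsOpenQuotientMap fun v : {v : EuclideanSpace ℝ (Fin (m + 1)) // v ≠ 0} =>
      RP.line v.1 v.2 := by
  have hquotient : IsQuotientMap fun v : {v : EuclideanSpace ℝ (Fin (m + 1)) // v ≠ 0} =>
      RP.line v.1 v.2 :=
    (isQuotientMap_quotient_mk' (s := projectivizationSetoid ℝ (Fin (m + 1) → ℝ))).comp
      ((PiLp.homeomorph 2 fun _ : Fin (m + 1) => ℝ).subtype
        fun v => (WithLp.ofLp_eq_zero 2).not.symm).isQuotientMap
  refine ⟨hquotient.surjective, hquotient.continuous, fun U hU => ?_⟩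
  rw [← hquotient.isOpen_preimage]
  let scale (c : ℝˣ) (v : {v : EuclideanSpace ℝ (Fin (m + 1)) // v ≠ 0}) :
      {v : EuclideanSpace ℝ (Fin (m + 1)) // v ≠ 0} :=
    ⟨c • v.1, (smul_ne_zero_iff_ne c).2 v.2⟩
  convert isOpen_iUnion fun c => hU.preimage
    (show Continuous (scale c) from (continuous_subtype_val.const_smul c).subtype_mk _)
  ext v
  simp only [Set.mem_preimage, Set.mem_image, Set.mem_iUnion, RP.line_eq_line_iff]
  constructor
  · rintro ⟨w, hw, c, hc⟩
    have hc0 : c ≠ 0 := fun h => w.2 (by rw [← hc, h, zero_smul])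
    exact ⟨Units.mk0 c hc0, (Subtype.ext hc : scale (Units.mk0 c hc0) v = w) ▸ hw⟩
  · rintro ⟨c, hc⟩
    exact ⟨_, hc, c, rfl⟩

theorem RP.continuous_line {Y : Type*} [TopologicalSpace Y]
    {v : Y → EuclideanSpace ℝ (Fin (m + 1))} (hv : Continuous v) (hne : ∀ y, v y ≠ 0) :
    Continuous fun y => RP.line (v y) (hne y) :=
  RP.isOpenQuotientMap_line.continuous.comp (hv.subtype_mk hne)

instance : CompactSpace (RP m) := by
  have hcontinuous : Continuous fun v : Metric.sphere (0 : EuclideanSpace ℝ (Fin (m + 1))) 1 =>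
      RP.line v.1 (ne_zero_of_mem_unit_sphere v) := RP.continuous_line continuous_subtype_val _
  refine Function.Surjective.compactSpace hcontinuous fun ℓ => ?_
  obtain ⟨v, hv, rfl⟩ := RP.exists_line_eq ℓ
  exact ⟨⟨‖v‖⁻¹ • v, by simp [norm_smul, hv]⟩, RP.line_eq_line_iff.2 ⟨‖v‖⁻¹, rfl⟩⟩

/-- The unit vector `v ⊗ v / ‖v‖²` depends only on the line spanned by `v`; this is the Veronese
embedding of `ℝP^m` into a Euclidean space. -/
noncomputable def RP.veronese : RP m → EuclideanSpace ℝ (Fin (m + 1) × Fin (m + 1)) :=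
  Projectivization.lift (fun v : {v : Fin (m + 1) → ℝ // v ≠ 0} =>
    WithLp.toLp 2 fun k => v.1 k.1 * v.1 k.2 / ‖WithLp.toLp 2 v.1‖ ^ 2) (by
  rintro ⟨_, hv⟩ ⟨w, hw⟩ c rfl
  have hc : c ≠ 0 := fun h => hv (by simp [h])
  ext k
  simp only [Pi.smul_apply, smul_eq_mul, WithLp.toLp_smul, norm_smul, Real.norm_eq_abs, mul_pow,
    sq_abs]
  rw [mul_mul_mul_comm, ← sq, mul_div_mul_left _ _ (pow_ne_zero 2 hc)])

theorem RP.veronese_line (v : EuclideanSpace ℝ (Fin (m + 1))) (hv : v ≠ 0) :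
    (RP.line v hv).veronese = WithLp.toLp 2 fun k => v k.1 * v k.2 / ‖v‖ ^ 2 := rfl

theorem RP.inner_veronese_line (v w : EuclideanSpace ℝ (Fin (m + 1))) (hv : v ≠ 0) (hw : w ≠ 0) :
    inner ℝ (RP.line v hv).veronese (RP.line w hw).veronese =
      (inner ℝ v w / (‖v‖ * ‖w‖)) ^ 2 := by
  simp only [RP.veronese_line, PiLp.inner_apply, RCLike.inner_apply, conj_trivial,
    Fintype.sum_prod_type, Finset.sum_div]
  rw [sq (∑ i, _ / _), Finset.sum_mul_sum]
  refine Finset.sum_congr rfl fun i _ => Finset.sum_congr rfl fun j _ => ?_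
  ring

theorem RP.norm_veronese (ℓ : RP m) : ‖ℓ.veronese‖ = 1 := by
  obtain ⟨v, hv, rfl⟩ := RP.exists_line_eq ℓ
  have hv' := norm_ne_zero_iff.2 hv
  rw [← sq_eq_sq₀ (norm_nonneg _) zero_le_one, ← real_inner_self_eq_norm_sq,
    RP.inner_veronese_line, real_inner_self_eq_norm_mul_norm, div_self (mul_ne_zero hv' hv')]

theorem RP.dist_veronese_sq (ℓ ℓ' : RP m) :
    dist ℓ.veronese ℓ'.veronese ^ 2 = 2 - 2 * inner ℝ ℓ.veronese ℓ'.veronese := by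
  rw [dist_eq_norm, norm_sub_sq_real, RP.norm_veronese, RP.norm_veronese]
  ring

theorem RP.continuous_veronese : Continuous (RP.veronese (m := m)) := by
  rw [RP.isOpenQuotientMap_line.isQuotientMap.continuous_iff]
  have hne (v : {v : EuclideanSpace ℝ (Fin (m + 1)) // v ≠ 0}) : ‖v.1‖ ^ 2 ≠ 0 :=
    pow_ne_zero 2 (norm_ne_zero_iff.2 v.2)
  change Continuous fun v : {v : EuclideanSpace ℝ (Fin (m + 1)) // v ≠ 0} =>
    WithLp.toLp 2 fun k : Fin (m + 1) × Fin (m + 1) => v.1 k.1 * v.1 k.2 / ‖v.1‖ ^ 2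
  fun_prop (disch := exact hne _)

theorem RP.veronese_injective : Function.Injective (RP.veronese (m := m)) := by
  intro ℓ ℓ' h
  obtain ⟨v, hv, rfl⟩ := RP.exists_line_eq ℓ
  obtain ⟨w, hw, rfl⟩ := RP.exists_line_eq ℓ'
  have hinner : |inner ℝ w v / (‖w‖ * ‖v‖)| = 1 := by
    rw [← sq_eq_sq₀ (abs_nonneg _) zero_le_one, sq_abs, ← RP.inner_veronese_line w v hw hv, h,
      real_inner_self_eq_norm_sq, RP.norm_veronese]
  obtain ⟨-, c, -, hc⟩ := (abs_real_inner_div_norm_mul_norm_eq_one_iff w v).1 hinner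
  exact RP.line_eq_line_iff.2 ⟨c, hc.symm⟩

theorem RP.isEmbedding_veronese : IsEmbedding (RP.veronese (m := m)) :=
  (RP.continuous_veronese.isClosedEmbedding RP.veronese_injective).isEmbedding

instance : T2Space (RP m) := RP.isEmbedding_veronese.t2Space

/-- The vector `a` lies on the line `ℓ`. -/
def RP.Incident (ℓ : RP m) (a : EuclideanSpace ℝ (Fin (m + 1))) : Prop :=
  ∀ ha : a ≠ 0, RP.line a ha = ℓ

theorem RP.incident_smul_iff {ℓ : RP m} {a : EuclideanSpace ℝ (Fin (m + 1))} {c : ℝ} (hc : c ≠ 0) :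
    ℓ.Incident (c • a) ↔ ℓ.Incident a := by
  have key (ha : a ≠ 0) : RP.line (c • a) (smul_ne_zero hc ha) = RP.line a ha :=
    RP.line_eq_line_iff.2 ⟨c, rfl⟩
  exact ⟨fun h ha => key ha ▸ h _, fun h hca => key (right_ne_zero_of_smul hca) ▸ h _⟩

theorem RP.isClosed_setOf_incident {Y : Type*} [TopologicalSpace Y] {ℓ : Y → RP m}
    {a : Y → EuclideanSpace ℝ (Fin (m + 1))} (hℓ : Continuous ℓ) (ha : Continuous a) :
    IsClosed {y | (ℓ y).Incident (a y)} := by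
  suffices h : IsClosed {x : RP m × EuclideanSpace ℝ (Fin (m + 1)) | x.1.Incident x.2} from
    h.preimage (hℓ.prodMk ha)
  rw [← (RP.isOpenQuotientMap_line.prodMap IsOpenQuotientMap.id).isQuotientMap.isClosed_preimage]
  convert isClosed_eq
    (f := fun x : {v : EuclideanSpace ℝ (Fin (m + 1)) // v ≠ 0} × EuclideanSpace ℝ (Fin (m + 1)) =>
      ‖x.1.1‖ ^ 2 • x.2)
    (g := fun x => inner ℝ x.1.1 x.2 • x.1.1) (by fun_prop) (by fun_prop) using 1
  ext ⟨v, a⟩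
  simp only [RP.Incident, RP.line_eq_line_iff_norm_smul, Set.mem_preimage, Set.mem_ofPred_eq,
    Prod.map_fst, Prod.map_snd, id_eq]
  exact ⟨fun h => by by_cases ha : a = 0 <;> simp_all, fun h _ => h⟩

end ProjectiveSpace

/-! ### Loops defined by tuples of monic forms -/

section LoopMap

variable {m n : ℕ}

/-- The vector of values at `w = (u, v)` of the monic forms with coefficients `P 0, …, P m`. -/
noncomputable def formsAt (P : Fin (m + 1) → Fin n → ℝ) (w : EuclideanSpace ℝ (Fin 2)) :
    EuclideanSpace ℝ (Fin (m + 1)) :=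
  WithLp.toLp 2 fun i => monicForm (P i) (w 0) (w 1)

theorem formsAt_smul (P : Fin (m + 1) → Fin n → ℝ) (c : ℝ) (w : EuclideanSpace ℝ (Fin 2)) :
    formsAt P (c • w) = c ^ n • formsAt P w :=
  PiLp.ext fun _ => monicForm_mul_mul _ _ _ _

theorem formsAt_infinity (P : Fin (m + 1) → Fin n → ℝ) (u : ℝ) :
    formsAt P !₂[u, 0] = WithLp.toLp 2 fun _ => u ^ n :=
  PiLp.ext fun _ => monicForm_infinity _ _

theorem formsAt_convexComb (P Q : Fin (m + 1) → Fin n → ℝ) {s t : ℝ} (h : s + t = 1)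
    (w : EuclideanSpace ℝ (Fin 2)) :
    formsAt (s • P + t • Q) w = s • formsAt P w + t • formsAt Q w :=
  PiLp.ext fun _ => monicForm_convexComb _ _ h _ _

@[fun_prop]
theorem continuous_formsAt {X : Type*} [TopologicalSpace X] {P : X → Fin (m + 1) → Fin n → ℝ}
    {w : X → EuclideanSpace ℝ (Fin 2)} (hP : Continuous P) (hw : Continuous w) :
    Continuous fun x => formsAt (P x) (w x) := by
  unfold formsAt
  fun_prop

theorem eq_smul_infinity_or_eq_smul_affine (w : EuclideanSpace ℝ (Fin 2)) :
    w = w 0 • !₂[(1 : ℝ), 0] ∨ w 1 ≠ 0 ∧ w = w 1 • !₂[w 0 / w 1, 1] := by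
  by_cases h : w 1 = 0
  · refine Or.inl (PiLp.ext fun i => ?_)
    fin_cases i <;> simp [h]
  · refine Or.inr ⟨h, PiLp.ext fun i => ?_⟩
    fin_cases i <;> simp [mul_div_cancel₀ _ h]

theorem affine_ne_zero (x : ℝ) : !₂[x, 1] ≠ 0 := fun h =>
  one_ne_zero (congrFun (congrArg WithLp.ofLp h) 1)

theorem toLp_const_ne_zero {c : ℝ} (hc : c ≠ 0) :
    (WithLp.toLp 2 fun _ => c : EuclideanSpace ℝ (Fin (m + 1))) ≠ 0 := fun h =>
  hc (congrFun (congrArg WithLp.ofLp h) 0)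

theorem infinity_vec_ne_zero : !₂[(1 : ℝ), 0] ≠ 0 := fun h =>
  one_ne_zero (congrFun (congrArg WithLp.ofLp h) 0)

theorem basePoint_eq_line :
    basePoint m = RP.line (WithLp.toLp 2 fun _ => 1) (toLp_const_ne_zero one_ne_zero) := rfl

theorem eq_infinity_or_eq_affinePoint (ℓ : RP 1) : ℓ = infinity ∨ ∃ x, ℓ = affinePoint x := by
  obtain ⟨w, hw, rfl⟩ := RP.exists_line_eq ℓ
  rcases eq_smul_infinity_or_eq_smul_affine w with h | ⟨-, h⟩
  · exact Or.inl ((RP.line_eq_line_iff (hw := infinity_vec_ne_zero)).2 ⟨w 0, h.symm⟩)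
  · exact Or.inr ⟨w 0 / w 1, (RP.line_eq_line_iff (hw := affine_ne_zero _)).2 ⟨w 1, h.symm⟩⟩

theorem loopRP_ext {f g : LoopRP m} (h : ∀ x, f.1 (affinePoint x) = g.1 (affinePoint x)) :
    f = g := by
  refine Subtype.ext (ContinuousMap.ext fun ℓ => ?_)
  rcases eq_infinity_or_eq_affinePoint ℓ with rfl | ⟨x, rfl⟩
  · rw [f.2, g.2]
  · exact h x

/-- The coefficients of `m + 1` monic polynomials of degree `n` without a common real zero, that
is, of forms without a common zero on `ℝP^1`. -/
def monicTuple (n m : ℕ) : Set (Fin (m + 1) → Fin n → ℝ) :=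
  {P | ∀ w, w ≠ 0 → formsAt P w ≠ 0}

theorem formsAt_affine (P : Fin (m + 1) → Fin n → ℝ) (x : ℝ) :
    formsAt P !₂[x, 1] = WithLp.toLp 2 fun i => (monicPoly (P i)).eval x :=
  PiLp.ext fun _ => monicForm_eq_eval _ _

theorem mem_monicTuple_iff {P : Fin (m + 1) → Fin n → ℝ} :
    P ∈ monicTuple n m ↔ ∀ x : ℝ, formsAt P !₂[x, 1] ≠ 0 := by
  refine ⟨fun h x => h _ (affine_ne_zero x), fun h w hw => ?_⟩
  rcases eq_smul_infinity_or_eq_smul_affine w with hw' | ⟨h1, hw'⟩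
  · have h0 : w 0 ≠ 0 := fun h0 => hw (by rw [hw', h0, zero_smul])
    rw [hw', formsAt_smul, formsAt_infinity]
    exact smul_ne_zero (pow_ne_zero n h0) (toLp_const_ne_zero (pow_ne_zero n one_ne_zero))
  · rw [hw', formsAt_smul]
    exact smul_ne_zero (pow_ne_zero n h1) (h _)

/-- Evaluation at a point of `ℝP^1` of the loop defined by a tuple of forms. -/
noncomputable def loopEval (q : monicTuple n m × RP 1) : RP m :=
  Projectivization.lift (fun w : {w : Fin 2 → ℝ // w ≠ 0} =>
    RP.line (formsAt q.1.1 (WithLp.toLp 2 w.1)) (q.1.2 _ ((WithLp.toLp_eq_zero 2).not.2 w.2))) (by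
      rintro ⟨_, hv⟩ ⟨w, hw⟩ c rfl
      exact RP.line_eq_line_iff.2 ⟨c ^ n, (formsAt_smul _ _ _).symm⟩) q.2

theorem continuous_loopEval : Continuous (loopEval (n := n) (m := m)) := by
  rw [(IsOpenQuotientMap.id.prodMap RP.isOpenQuotientMap_line).isQuotientMap.continuous_iff]
  exact RP.continuous_line (v := fun q : monicTuple n m × {w : EuclideanSpace ℝ (Fin 2) // w ≠ 0} =>
    formsAt q.1.1 q.2.1) (by fun_prop) fun q => q.1.2 _ q.2.2

/-- The loop defined by a tuple of monic polynomials, as a function of the tuple. -/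
noncomputable def loopMap (n m : ℕ) : C(monicTuple n m, LoopRP m) where
  toFun P := ⟨ContinuousMap.curry ⟨loopEval, continuous_loopEval⟩ P, by
    change RP.line (formsAt P.1 !₂[1, 0]) (P.2 _ infinity_vec_ne_zero) = _
    simp only [formsAt_infinity, one_pow, basePoint_eq_line]⟩
  continuous_toFun := by fun_prop

theorem loopMap_line (P : monicTuple n m) {w : EuclideanSpace ℝ (Fin 2)} (hw : w ≠ 0) :
    (loopMap n m P).1 (RP.line w hw) = RP.line (formsAt P.1 w) (P.2 w hw) := rfl

theorem loopMap_affinePoint (P : monicTuple n m) (x : ℝ) :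
    (loopMap n m P).1 (affinePoint x) =
      RP.line (formsAt P.1 !₂[x, 1]) (mem_monicTuple_iff.1 P.2 x) := rfl

theorem loopMap_eq_of_incident {P : monicTuple n m} {f : LoopRP m}
    (h : ∀ x, (f.1 (affinePoint x)).Incident (formsAt P.1 !₂[x, 1])) : loopMap n m P = f :=
  loopRP_ext fun x => h x (mem_monicTuple_iff.1 P.2 x)

/-- The coefficients of monic polynomials of degree `n` without a common complex root. -/
def coprimeTuple (n m : ℕ) : Set (Fin (m + 1) → Fin n → ℝ) :=
  {P | ∀ z : ℂ, ∃ i, aeval z (monicPoly (P i)) ≠ 0}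

theorem exists_eval_ne_zero_of_aeval_ne_zero {ι : Type*} {p : ι → ℝ[X]}
    (hp : ∀ z : ℂ, ∃ i, aeval z (p i) ≠ 0) (x : ℝ) : ∃ i, (p i).eval x ≠ 0 := by
  obtain ⟨i, hi⟩ := hp (algebraMap ℝ ℂ x)
  exact ⟨i, fun h => hi (by rw [aeval_algebraMap_apply_eq_algebraMap_eval, h, map_zero])⟩

theorem coprimeTuple_subset_monicTuple : coprimeTuple n m ⊆ monicTuple n m := fun P hP => by
  refine mem_monicTuple_iff.2 fun x h => ?_
  obtain ⟨i, hi⟩ := exists_eval_ne_zero_of_aeval_ne_zero hP x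
  rw [formsAt_affine] at h
  exact hi (congrFun (congrArg WithLp.ofLp h) i)

theorem monicPoly_coef {p : ℝ[X]} (hp : p.Monic) (hn : p.natDegree = n) :
    monicPoly (coef n p) = p :=
  Polynomial.funext fun x => by rw [← monicForm_eq_eval, monicForm_coef hp hn]

theorem mem_exactRat_iff {f : LoopRP m} :
    f ∈ exactRat n m ↔ ∃ P : monicTuple n m, P.1 ∈ coprimeTuple n m ∧ loopMap n m P = f := by
  constructor
  · rintro ⟨p, hp, hroot, hf⟩
    have hcoef (i) : monicPoly (coef n (p i)) = p i := monicPoly_coef (hp i).1 (hp i).2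
    have hP : (fun i => coef n (p i)) ∈ coprimeTuple n m :=
      fun z => by simpa only [hcoef] using hroot z
    refine ⟨⟨_, coprimeTuple_subset_monicTuple hP⟩, hP, loopMap_eq_of_incident fun x ha => ?_⟩
    obtain ⟨h, hx⟩ := hf x
    simp only [formsAt_affine, hcoef, hx]
    rfl
  · rintro ⟨P, hP, rfl⟩
    refine ⟨fun i => monicPoly (P.1 i), fun i => ⟨monic_monicPoly _, natDegree_monicPoly _⟩, hP,
      fun x => ⟨fun h => mem_monicTuple_iff.1 P.2 x ?_, ?_⟩⟩
    · rw [formsAt_affine, h]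
      rfl
    · rw [loopMap_affinePoint]
      simp only [formsAt_affine]
      rfl

theorem monicPoly_add_smul_coef_one [NeZero n] (a : Fin n → ℝ) (s : ℝ) :
    monicPoly (a + s • coef n 1) = monicPoly a + C s :=
  Polynomial.funext fun x => by
    rw [eval_add, eval_C, ← monicForm_eq_eval, ← monicForm_eq_eval, monicForm, lowForm_add,
      lowForm_smul, lowForm_coef_one, monicForm, smul_eq_mul, mul_one, add_assoc]

theorem loopMap_mem_rat [NeZero n] [NeZero m] (P : monicTuple n m) : loopMap n m P ∈ rat n m := by
  let perturb (s : ℝ) : Fin (m + 1) → Fin n → ℝ := P.1 + Pi.single (Fin.last m) (s • coef n 1)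
  let bad : Set ℝ := (fun z : ℂ => -(aeval z (monicPoly (P.1 (Fin.last m)))).re) ''
    (monicPoly (P.1 0)).rootSet ℂ
  have hbad : bad.Finite := (rootSet_finite _ _).image _
  have hperturb (s : ℝ) (hs : s ∈ badᶜ) : perturb s ∈ coprimeTuple n m := by
    intro z
    by_cases hz : aeval z (monicPoly (P.1 0)) = 0
    · refine ⟨Fin.last m, fun h => hs
        ⟨z, (mem_rootSet_of_ne (monic_monicPoly _).ne_zero).2 hz, ?_⟩⟩
      simp only [perturb, Pi.add_apply, Pi.single_eq_same, monicPoly_add_smul_coef_one, map_add,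
        aeval_C, Complex.coe_algebraMap] at h
      have hre := congrArg Complex.re h
      rw [Complex.add_re, Complex.ofReal_re, Complex.zero_re] at hre
      linarith
    · refine ⟨0, ?_⟩
      rwa [show perturb s 0 = P.1 0 by simp [perturb, (Fin.last_pos' (n := m)).ne]]
  have hclosure : P ∈ closure (Subtype.val ⁻¹' coprimeTuple n m : Set (monicTuple n m)) := by
    rw [closure_subtype, Subtype.image_preimage_coe,
      Set.inter_eq_self_of_subset_right coprimeTuple_subset_monicTuple,
      show P.1 = perturb 0 by simp [perturb]]
    have hcontinuous : Continuous perturb :=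
      continuous_const.add ((continuous_single _).comp (by fun_prop))
    exact map_mem_closure hcontinuous (hbad.countable.dense_compl ℝ 0) hperturb
  exact map_mem_closure (loopMap n m).continuous hclosure
    fun Q hQ => mem_exactRat_iff.2 ⟨Q, hQ, rfl⟩

end LoopMap

/-! ### Limits of rational loops are rational -/

section Range

variable {m n d : ℕ}

/-- The loop `g` is given by the polynomials `Q 0, …, Q m` wherever these do not all vanish. -/
def Represents (Q : Fin (m + 1) → ℝ[X]) (g : LoopRP m) : Prop :=
  ∀ x : ℝ, (g.1 (affinePoint x)).Incident (WithLp.toLp 2 fun i => (Q i).eval x)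

theorem continuous_affinePoint : Continuous affinePoint :=
  RP.continuous_line (v := fun x : ℝ => !₂[x, 1]) (by fun_prop) affine_ne_zero

theorem isClosed_setOf_incident_lowForm :
    IsClosed {q : LoopRP m × (Fin (m + 1) → Fin n → ℝ) | ∀ x : ℝ,
      (q.1.1 (affinePoint x)).Incident (WithLp.toLp 2 fun i => lowForm (q.2 i) x 1)} := by
  simp only [Set.ofPred_forall]
  exact isClosed_iInter fun x => RP.isClosed_setOf_incident
    ((continuous_eval_const (affinePoint x)).comp (continuous_subtype_val.comp continuous_fst))
    ((PiLp.continuous_toLp 2 _).comp (continuous_pi fun i => continuous_lowForm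
      ((continuous_apply i).comp continuous_snd) continuous_const continuous_const))

theorem exists_represents_of_mem_rat {g : LoopRP m} (hg : g ∈ rat n m) :
    ∃ Q : Fin (m + 1) → ℝ[X], Q ≠ 0 ∧ (∀ i, (Q i).natDegree ≤ n) ∧ Represents Q g := by
  let S := Metric.sphere (0 : Fin (m + 1) → Fin (n + 1) → ℝ) 1
  have : CompactSpace S := isCompact_iff_compactSpace.1 (isCompact_sphere _ _)
  let represented : Set (LoopRP m × S) := {q | ∀ x : ℝ,
    (q.1.1 (affinePoint x)).Incident (WithLp.toLp 2 fun i => lowForm (q.2.1 i) x 1)}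
  have hclosed : IsClosed represented :=
    isClosed_setOf_incident_lowForm.preimage (continuous_id.prodMap continuous_subtype_val)
  have hsubset : exactRat n m ⊆ Prod.fst '' represented := by
    rintro f ⟨p, hp, -, h⟩
    have hdegree (i) : (p i).degree < (n + 1 : ℕ) :=
      (degree_le_of_natDegree_le (hp i).2.le).trans_lt (Nat.cast_lt.2 n.lt_succ_self)
    let c : Fin (m + 1) → Fin (n + 1) → ℝ := fun i => coef (n + 1) (p i)
    have hc : c ≠ 0 := fun h0 => one_ne_zero (α := ℝ) <| by
      rw [← (hp 0).1.coeff_natDegree, (hp 0).2]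
      exact congrFun (congrFun h0 0) (Fin.last n)
    refine ⟨(f, ⟨‖c‖⁻¹ • c, by
      rw [mem_sphere_zero_iff_norm, norm_smul, norm_inv, norm_norm,
        inv_mul_cancel₀ (norm_ne_zero_iff.2 hc)]⟩), fun x => ?_, rfl⟩
    have heval : (WithLp.toLp 2 fun i => lowForm ((‖c‖⁻¹ • c) i) x 1) =
        ‖c‖⁻¹ • WithLp.toLp 2 fun i => (p i).eval x := PiLp.ext fun i => by
      change lowForm (‖c‖⁻¹ • coef (n + 1) (p i)) x 1 = _
      rw [lowForm_smul, lowForm_coef (hdegree i)]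
      rfl
    simp only [heval]
    refine (RP.incident_smul_iff (inv_ne_zero (norm_ne_zero_iff.2 hc))).2 fun _ => ?_
    exact (h x).choose_spec.symm
  obtain ⟨⟨g', c⟩, hc, rfl⟩ :=
    closure_minimal hsubset (isClosedMap_fst_of_compactSpace _ hclosed) hg
  refine ⟨fun i => lowPoly (c.1 i), fun h0 => ne_zero_of_mem_unit_sphere c ?_, fun i => ?_,
    fun x => by simpa only [lowForm_eq_eval, Algebra.algebraMap_self_apply] using hc x⟩
  · exact _root_.funext fun i => by
      rw [← coef_lowPoly (c.1 i), show lowPoly (c.1 i) = 0 from congrFun h0 i, map_zero]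
      rfl
  · exact natDegree_le_iff_coeff_eq_zero.2 fun k hk =>
      coeff_eq_zero_of_degree_lt ((degree_lowPoly _).trans_le (Nat.cast_le.2 hk))

theorem Represents.of_mul {g : LoopRP m} {R : Fin (m + 1) → ℝ[X]} {q : ℝ[X]} (hq : q ≠ 0)
    (h : Represents (fun i => q * R i) g) : Represents R g := by
  have hclosed : IsClosed {x : ℝ | (g.1 (affinePoint x)).Incident
      (WithLp.toLp 2 fun i => (R i).eval x)} :=
    RP.isClosed_setOf_incident (g.1.continuous.comp continuous_affinePoint) (by fun_prop)
  have hdense : Dense {x | q.IsRoot x}ᶜ := (finite_setOfPred_isRoot hq).countable.dense_compl ℝ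
  have hoff (x : ℝ) (hx : ¬ q.IsRoot x) : (g.1 (affinePoint x)).Incident
      (WithLp.toLp 2 fun i => (R i).eval x) := by
    refine (RP.incident_smul_iff hx).1 ?_
    convert h x using 1
    exact PiLp.ext fun i => eval_mul.symm
  exact fun x => hclosed.closure_subset_iff.2 hoff (hdense x)

theorem exists_eq_mul_and_sum_mul_eq_one {A ι : Type*} [CommRing A] [IsDomain A]
    [IsPrincipalIdealRing A] [Fintype ι] {Q : ι → A} (hQ : Q ≠ 0) :
    ∃ q ≠ 0, ∃ R : ι → A, (∀ i, Q i = q * R i) ∧ ∃ a : ι → A, ∑ i, a i * R i = 1 := by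
  obtain ⟨q, hq⟩ := IsPrincipalIdealRing.principal (Ideal.span (Set.range Q))
  have hdvd (i) : q ∣ Q i := Ideal.mem_span_singleton.1
    (hq.le (Ideal.subset_span (Set.mem_range_self i)))
  choose R hR using hdvd
  have hq0 : q ≠ 0 := fun h0 => hQ (_root_.funext fun i => by rw [hR, h0, zero_mul, Pi.zero_apply])
  have hmem : q ∈ Ideal.span (Set.range Q) := hq.ge (Ideal.mem_span_singleton_self q)
  obtain ⟨a, ha⟩ := Ideal.mem_span_range_iff_exists_fun.1 hmem
  refine ⟨q, hq0, R, hR, a, mul_left_cancel₀ hq0 ?_⟩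
  rw [mul_one, Finset.mul_sum]
  exact (Finset.sum_congr rfl fun i _ => by rw [hR, mul_left_comm]).trans ha

theorem tendsto_eval_div_pow_atTop {P : ℝ[X]} {k : ℕ} (hP : P.natDegree ≤ k) :
    Tendsto (fun x => P.eval x / x ^ k) atTop (𝓝 (P.coeff k)) := by
  have heval : (fun x : ℝ => P.eval x / x ^ k) = fun x => P.eval x / (X ^ k : ℝ[X]).eval x := by
    simp only [eval_pow, eval_X]
  rw [heval]
  rcases (degree_le_of_natDegree_le hP).lt_or_eq with h | h
  · rw [coeff_eq_zero_of_degree_lt h]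
    exact div_tendsto_atTop_zero_of_degree_lt _ _ (by rwa [degree_X_pow])
  · have hlimit := div_tendsto_atTop_leadingCoeff_div_of_degree_eq P (X ^ k)
      (by rw [h, degree_X_pow])
    rwa [leadingCoeff_X_pow, div_one, leadingCoeff, natDegree_eq_of_degree_eq_some h] at hlimit

theorem tendsto_affinePoint_atTop : Tendsto affinePoint atTop (𝓝 infinity) := by
  have hne (t : ℝ) : !₂[1, t] ≠ 0 := fun h => one_ne_zero (congrFun (congrArg WithLp.ofLp h) 0)
  have hcontinuous : Continuous fun t : ℝ => RP.line !₂[1, t] (hne t) :=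
    RP.continuous_line (by fun_prop) hne
  refine (hcontinuous.tendsto 0 |>.comp tendsto_inv_atTop_zero).congr' ?_
  filter_upwards [eventually_ne_atTop 0] with x hx
  change RP.line !₂[1, x⁻¹] (hne _) = RP.line !₂[x, 1] (affine_ne_zero x)
  refine RP.line_eq_line_iff.2 ⟨x⁻¹, PiLp.ext fun i => ?_⟩
  fin_cases i <;> simp [hx]

theorem Represents.incident_coeff {g : LoopRP m} {R : Fin (m + 1) → ℝ[X]} (h : Represents R g)
    {k : ℕ} (hk : ∀ i, (R i).natDegree ≤ k) :
    (basePoint m).Incident (WithLp.toLp 2 fun i => (R i).coeff k) := by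
  have hclosed : IsClosed {x : RP m × EuclideanSpace ℝ (Fin (m + 1)) | x.1.Incident x.2} :=
    RP.isClosed_setOf_incident continuous_fst continuous_snd
  have hpoint := (g.1.continuous.tendsto infinity).comp tendsto_affinePoint_atTop
  have hvector : Tendsto (fun x : ℝ => (x ^ k)⁻¹ • WithLp.toLp 2 fun i => (R i).eval x) atTop
      (𝓝 (WithLp.toLp 2 fun i => (R i).coeff k)) := by
    refine ((PiLp.continuous_toLp 2 _).tendsto _).comp (tendsto_pi_nhds.2 fun i => ?_)
    exact (tendsto_eval_div_pow_atTop (hk i)).congr fun x => div_eq_inv_mul _ _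
  rw [← g.2]
  refine hclosed.mem_of_tendsto (hpoint.prodMk_nhds hvector) ?_
  filter_upwards [eventually_ne_atTop 0] with x hx
  exact (RP.incident_smul_iff (inv_ne_zero (pow_ne_zero k hx))).2 (h x)

theorem Represents.mem_exactRat {g : LoopRP m} {p : Fin (m + 1) → ℝ[X]} (h : Represents p g)
    (hp : ∀ i, (p i).Monic ∧ (p i).natDegree = d) (hroot : ∀ z : ℂ, ∃ i, aeval z (p i) ≠ 0) :
    g ∈ exactRat d m := by
  refine ⟨p, hp, hroot, fun x => ?_⟩
  obtain ⟨i, hi⟩ := exists_eval_ne_zero_of_aeval_ne_zero hroot x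
  have hne : (fun i => (p i).eval x) ≠ 0 := fun h0 => hi (congrFun h0 i)
  exact ⟨hne, (h x ((WithLp.toLp_eq_zero 2).not.2 hne)).symm⟩

theorem Represents.exists_mem_exactRat {g : LoopRP m} {R : Fin (m + 1) → ℝ[X]}
    (h : Represents R g) (hroot : ∀ z : ℂ, ∃ i, aeval z (R i) ≠ 0) :
    ∃ i, g ∈ exactRat (R i).natDegree m := by
  obtain ⟨i₀, -, hmax⟩ := Finset.exists_max_image Finset.univ (fun i => (R i).degree)
    Finset.univ_nonempty
  replace hmax (i) := hmax i (Finset.mem_univ i)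
  have hR : R i₀ ≠ 0 := fun h0 => by
    obtain ⟨j, hj⟩ := hroot 0
    have hj0 := hmax j
    rw [h0, degree_zero, le_bot_iff, degree_eq_bot] at hj0
    exact hj (by rw [hj0, map_zero])
  refine ⟨i₀, ?_⟩
  set k := (R i₀).natDegree
  have hle (i) : (R i).natDegree ≤ k := natDegree_le_natDegree (hmax i)
  have hlead : (R i₀).coeff k ≠ 0 := leadingCoeff_ne_zero.2 hR
  obtain ⟨c, hc⟩ := RP.line_eq_line_iff.1
    ((h.incident_coeff hle fun h0 => hlead (congrFun (congrArg WithLp.ofLp h0) i₀)).trans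
      basePoint_eq_line)
  have hcoeff (i) : (R i).coeff k = c :=
    (congrFun (congrArg WithLp.ofLp hc) i).symm.trans (mul_one c)
  have hc0 : c ≠ 0 := hcoeff i₀ ▸ hlead
  have hdegree (i) : (R i).natDegree = k :=
    le_antisymm (hle i) (le_natDegree_of_ne_zero (by rwa [hcoeff]))
  refine Represents.mem_exactRat (p := fun i => C c⁻¹ * R i) (fun x => ?_) (fun i => ⟨?_, ?_⟩)
    fun z => ?_
  · convert (RP.incident_smul_iff (inv_ne_zero hc0)).2 (h x) using 1
    exact PiLp.ext fun i => eval_C_mul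
  · exact monic_C_mul_of_mul_leadingCoeff_eq_one (by
      rw [leadingCoeff, hdegree, hcoeff, inv_mul_cancel₀ hc0])
  · rw [natDegree_C_mul (inv_ne_zero hc0), hdegree]
  · obtain ⟨i, hi⟩ := hroot z
    exact ⟨i, by simpa [hc0] using hi⟩

theorem exists_mem_exactRat_of_mem_rat {g : LoopRP m} (hg : g ∈ rat n m) :
    ∃ d ≤ n, g ∈ exactRat d m := by
  obtain ⟨Q, hQ, hdegree, hQg⟩ := exists_represents_of_mem_rat hg
  obtain ⟨q, hq, R, hR, a, ha⟩ := exists_eq_mul_and_sum_mul_eq_one hQ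
  have hroot (z : ℂ) : ∃ i, aeval z (R i) ≠ 0 := by
    by_contra! h
    simpa [h] using congrArg (aeval z) ha
  have hRg : Represents R g := Represents.of_mul hq (by simpa only [← hR] using hQg)
  obtain ⟨i, hi⟩ := hRg.exists_mem_exactRat hroot
  refine ⟨_, ?_, hi⟩
  rcases eq_or_ne (R i) 0 with h0 | h0
  · rw [h0, natDegree_zero]
    exact n.zero_le
  · refine (natDegree_le_of_dvd (hR i ▸ Dvd.intro_left q rfl) ?_).trans (hdegree i)
    rw [hR]
    exact mul_ne_zero hq h0

theorem inner_formsAt_pos {P : Fin (m + 1) → Fin n → ℝ} {Q : Fin (m + 1) → Fin d → ℝ}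
    (h : ∀ w, w ≠ 0 → inner ℝ (formsAt P w) (formsAt Q w) ≠ 0) {w : EuclideanSpace ℝ (Fin 2)}
    (hw : w ≠ 0) : 0 < inner ℝ (formsAt P w) (formsAt Q w) := by
  have hcontinuous : Continuous fun w => inner ℝ (formsAt P w) (formsAt Q w) := by fun_prop
  have hconnected : _root_.IsPreconnected ({0}ᶜ : Set (EuclideanSpace ℝ (Fin 2))) :=
    (isConnected_compl_singleton_of_one_lt_rank
      (Module.lt_rank_of_lt_finrank (by simp)) 0).isPreconnected
  have hone : 0 ≤ inner ℝ (formsAt P !₂[1, 0]) (formsAt Q !₂[1, 0]) := by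
    simp only [formsAt_infinity, one_pow]
    exact real_inner_self_nonneg
  by_contra hle
  obtain ⟨v, hv, hv0⟩ := hconnected.intermediate_value hw infinity_vec_ne_zero
    hcontinuous.continuousOn ⟨not_lt.1 hle, hone⟩
  exact h v hv hv0

theorem even_add_of_inner_formsAt_ne_zero {P : Fin (m + 1) → Fin n → ℝ}
    {Q : Fin (m + 1) → Fin d → ℝ}
    (h : ∀ w, w ≠ 0 → inner ℝ (formsAt P w) (formsAt Q w) ≠ 0) : Even (n + d) := by
  have hpos := inner_formsAt_pos h
    (smul_ne_zero (neg_ne_zero.2 (one_ne_zero (α := ℝ))) infinity_vec_ne_zero)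
  rw [formsAt_smul, formsAt_smul, inner_smul_left, inner_smul_right, ← mul_assoc, conj_trivial,
    ← pow_add] at hpos
  by_contra hodd
  rw [(Nat.not_even_iff_odd.1 hodd).neg_one_pow] at hpos
  have hone := inner_formsAt_pos h infinity_vec_ne_zero
  linarith

theorem eventually_lt_inner_veronese {Y : Type*} [TopologicalSpace Y] {c : Y → ℝ}
    {f : Y → LoopRP m} (hc : Continuous c) (hf : Continuous f) {y₀ : Y} (h : c y₀ < 1) :
    ∀ᶠ y in 𝓝 y₀, ∀ ℓ, c y < inner ℝ ((f y₀).1 ℓ).veronese ((f y).1 ℓ).veronese := by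
  have hcontinuous : Continuous fun q : Y × RP 1 =>
      inner ℝ ((f y₀).1 q.2).veronese ((f q.1).1 q.2).veronese := by
    have hf₀ := RP.continuous_veronese.comp
      (show Continuous fun q : Y × RP 1 => (f y₀).1 q.2 by fun_prop)
    have hf := RP.continuous_veronese.comp
      (show Continuous fun q : Y × RP 1 => (f q.1).1 q.2 by fun_prop)
    exact hf₀.inner hf
  have hopen := isOpen_setOf_forall_mem_compact isCompact_univ
    (isOpen_lt (hc.comp continuous_fst) hcontinuous)
  filter_upwards [hopen.mem_nhds fun ℓ _ => by simp [RP.norm_veronese, h]] with y hy ℓ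
  exact hy ℓ trivial

theorem even_add_of_mem_rat_of_mem_exactRat {g : LoopRP m} (hn : g ∈ rat n m)
    (hd : g ∈ exactRat d m) : Even (n + d) := by
  obtain ⟨f, hf, hpos⟩ := ((mem_closure_iff_frequently.1 hn).and_eventually
    (eventually_lt_inner_veronese (c := fun _ => 0) continuous_const continuous_id one_pos)).exists
  obtain ⟨Q, -, rfl⟩ := mem_exactRat_iff.1 hf
  obtain ⟨P, -, rfl⟩ := mem_exactRat_iff.1 hd
  rw [add_comm]
  refine even_add_of_inner_formsAt_ne_zero (P := P.1) (Q := Q.1) fun w hw h0 => ?_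
  have hw' := hpos (RP.line w hw)
  rw [id, id, loopMap_line, loopMap_line, RP.inner_veronese_line, h0, zero_div,
    zero_pow two_ne_zero] at hw'
  exact hw'.false

end Range

section Multiplication

variable {m k : ℕ}

theorem monic_sq_add_one_pow (j : ℕ) : ((X ^ 2 + 1) ^ j : ℝ[X]).Monic :=
  Monic.pow (by monicity!) j

theorem natDegree_sq_add_one_pow (j : ℕ) : ((X ^ 2 + 1) ^ j : ℝ[X]).natDegree = 2 * j := by
  rw [natDegree_pow, show (X ^ 2 + 1 : ℝ[X]).natDegree = 2 by compute_degree!, mul_comm]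

/-- The lower coefficients of the product of a monic polynomial with `(X² + 1) ^ j`. -/
noncomputable def mulCoef (j : ℕ) (a : Fin k → ℝ) : Fin (k + 2 * j) → ℝ :=
  coef (k + 2 * j) (monicPoly a * (X ^ 2 + 1) ^ j)

theorem monicForm_mulCoef (j : ℕ) (a : Fin k → ℝ) (x : ℝ) :
    monicForm (mulCoef j a) x 1 = (x ^ 2 + 1) ^ j * monicForm a x 1 := by
  rw [mulCoef, monicForm_coef ((monic_monicPoly a).mul (monic_sq_add_one_pow j)) (by
    rw [(monic_monicPoly a).natDegree_mul (monic_sq_add_one_pow j), natDegree_monicPoly,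
      natDegree_sq_add_one_pow]), monicForm_eq_eval]
  simp [mul_comm]

theorem continuous_mulCoef (j : ℕ) : Continuous (mulCoef (k := k) j) := by
  refine continuous_pi fun i => ?_
  simp only [mulCoef, coef_apply, monicPoly, lowPoly, add_mul, Finset.sum_mul, mul_assoc,
    coeff_add, finsetSum_coeff, coeff_C_mul]
  fun_prop

theorem formsAt_mulCoef (j : ℕ) (P : Fin (m + 1) → Fin k → ℝ) (x : ℝ) :
    formsAt (fun i => mulCoef j (P i)) !₂[x, 1] = (x ^ 2 + 1) ^ j • formsAt P !₂[x, 1] :=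
  PiLp.ext fun i => monicForm_mulCoef j (P i) x

/-- Multiplication of all polynomials of a tuple by `(X² + 1) ^ j`. -/
noncomputable def mulTuple (j : ℕ) : C(monicTuple k m, monicTuple (k + 2 * j) m) where
  toFun P := ⟨fun i => mulCoef j (P.1 i), mem_monicTuple_iff.2 fun x => by
    rw [formsAt_mulCoef]
    exact smul_ne_zero (by positivity) (mem_monicTuple_iff.1 P.2 x)⟩
  continuous_toFun := Continuous.subtype_mk (continuous_pi fun i =>
    (continuous_mulCoef j).comp ((continuous_apply i).comp continuous_subtype_val)) _

theorem loopMap_mulTuple (j : ℕ) (P : monicTuple k m) :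
    loopMap (k + 2 * j) m (mulTuple j P) = loopMap k m P :=
  loopRP_ext fun x => by
    rw [loopMap_affinePoint, loopMap_affinePoint]
    exact RP.line_eq_line_iff.2 ⟨(x ^ 2 + 1) ^ j, (formsAt_mulCoef j P.1 x).symm⟩

theorem range_loopMap (n m : ℕ) [NeZero n] [NeZero m] :
    Set.range (loopMap n m) = rat n m := by
  refine (Set.range_subset_iff.2 loopMap_mem_rat).antisymm fun g hg => ?_
  obtain ⟨d, hdn, hd⟩ := exists_mem_exactRat_of_mem_rat hg
  obtain ⟨r, hr⟩ := even_add_of_mem_rat_of_mem_exactRat hg hd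
  obtain ⟨j, rfl⟩ : ∃ j, n = d + 2 * j := ⟨(n - d) / 2, by omega⟩
  obtain ⟨P, -, rfl⟩ := mem_exactRat_iff.1 hd
  exact ⟨mulTuple j P, loopMap_mulTuple j P⟩

theorem rat_subset_rat_add_two_mul [NeZero k] [NeZero m] (j : ℕ) :
    rat k m ⊆ rat (k + 2 * j) m := by
  have : NeZero (k + 2 * j) := ⟨(NeZero.pos k).trans_le (k.le_add_right _) |>.ne'⟩
  rw [← range_loopMap, ← range_loopMap]
  rintro _ ⟨P, rfl⟩
  exact ⟨mulTuple j P, loopMap_mulTuple j P⟩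

end Multiplication

/-! ### Tuples of polynomials approximating a loop -/

section Approximation

variable {m n : ℕ}

/-- The tuples of monic polynomials defining loops that at all times make an angle of cosine
greater than `r` with the loop `f`. -/
def approximants (n : ℕ) (f : LoopRP m) (r : ℝ) : Set (Fin (m + 1) → Fin n → ℝ) :=
  {P | ∃ hP : P ∈ monicTuple n m, ∀ ℓ,
    r ^ 2 < inner ℝ ((loopMap n m ⟨P, hP⟩).1 ℓ).veronese (f.1 ℓ).veronese}

theorem mem_monicTuple_of_inner_pos {P Q : Fin (m + 1) → Fin n → ℝ}
    (h : ∀ w, w ≠ 0 → 0 < inner ℝ (formsAt P w) (formsAt Q w)) : P ∈ monicTuple n m :=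
  fun w hw h0 => by simpa [h0] using h w hw

theorem sq_lt_inner_veronese_loopMap_line_iff {P Q : monicTuple n m} {r : ℝ} (hr : 0 ≤ r)
    {w : EuclideanSpace ℝ (Fin 2)} (hw : w ≠ 0) (h : 0 < inner ℝ (formsAt P.1 w) (formsAt Q.1 w)) :
    r ^ 2 < inner ℝ ((loopMap n m P).1 (RP.line w hw)).veronese
        ((loopMap n m Q).1 (RP.line w hw)).veronese ↔
      r * (‖formsAt P.1 w‖ * ‖formsAt Q.1 w‖) < inner ℝ (formsAt P.1 w) (formsAt Q.1 w) := by
  have hnorm : 0 < ‖formsAt P.1 w‖ * ‖formsAt Q.1 w‖ :=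
    mul_pos (norm_pos_iff.2 (P.2 w hw)) (norm_pos_iff.2 (Q.2 w hw))
  rw [loopMap_line, loopMap_line, RP.inner_veronese_line,
    pow_lt_pow_iff_left₀ hr (div_pos h hnorm).le two_ne_zero, lt_div_iff₀ hnorm]

theorem mem_approximants_loopMap_iff {P : Fin (m + 1) → Fin n → ℝ} {Q : monicTuple n m} {r : ℝ}
    (hr : 0 ≤ r) : P ∈ approximants n (loopMap n m Q) r ↔
      ∀ w, w ≠ 0 → r * (‖formsAt P w‖ * ‖formsAt Q.1 w‖) <
        inner ℝ (formsAt P w) (formsAt Q.1 w) := by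
  constructor
  · rintro ⟨hP, h⟩ w hw
    refine (sq_lt_inner_veronese_loopMap_line_iff (P := ⟨P, hP⟩) hr hw ?_).1 (h _)
    refine inner_formsAt_pos (fun v hv h0 => ?_) hw
    have hv' := h (RP.line v hv)
    rw [loopMap_line, loopMap_line, RP.inner_veronese_line, h0, zero_div,
      zero_pow two_ne_zero] at hv'
    exact hv'.not_ge (sq_nonneg r)
  · intro h
    have hpos (w : EuclideanSpace ℝ (Fin 2)) (hw : w ≠ 0) :
        0 < inner ℝ (formsAt P w) (formsAt Q.1 w) :=
      (mul_nonneg hr (mul_nonneg (norm_nonneg _) (norm_nonneg _))).trans_lt (h w hw)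
    refine ⟨mem_monicTuple_of_inner_pos hpos, fun ℓ => ?_⟩
    obtain ⟨w, hw, rfl⟩ := RP.exists_line_eq ℓ
    exact (sq_lt_inner_veronese_loopMap_line_iff (P := ⟨P, _⟩) hr hw (hpos w hw)).2 (h w hw)

theorem dist_veronese_loopMap_le {f : LoopRP m} {P : monicTuple n m} {s : ℝ} (hs : 0 ≤ s)
    (h : P.1 ∈ approximants n f (1 - s)) (ℓ : RP 1) :
    dist ((loopMap n m P).1 ℓ).veronese (f.1 ℓ).veronese ≤ 2 * √s := by
  refine abs_le_of_sq_le_sq' ?_ (by positivity) |>.2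
  rw [RP.dist_veronese_sq, mul_pow, Real.sq_sqrt hs]
  have hℓ : (1 - s) ^ 2 < inner ℝ ((loopMap n m P).1 ℓ).veronese (f.1 ℓ).veronese :=
    h.choose_spec ℓ
  nlinarith [sq_nonneg s]

theorem isEmbedding_veronese_comp : IsEmbedding fun f : LoopRP m =>
    (⟨RP.veronese, RP.continuous_veronese⟩ : C(RP m, _)).comp f.1 :=
  (ContinuousMap.isEmbedding_postcomp _ RP.isEmbedding_veronese).comp .subtypeVal

variable [NeZero n] [NeZero m]

theorem convex_approximants {f : LoopRP m} (hf : f ∈ rat n m) {r : ℝ} (hr : 0 ≤ r) :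
    Convex ℝ (approximants n f r) := by
  rw [← range_loopMap] at hf
  obtain ⟨Q, rfl⟩ := hf
  refine convex_iff_forall_pos.2 fun P hP P' hP' a b ha hb hab => ?_
  rw [mem_approximants_loopMap_iff hr] at hP hP' ⊢
  intro w hw
  rw [formsAt_convexComb _ _ hab, inner_add_left, real_inner_smul_left, real_inner_smul_left]
  calc r * (‖a • formsAt P w + b • formsAt P' w‖ * ‖formsAt Q.1 w‖)
      ≤ r * ((a * ‖formsAt P w‖ + b * ‖formsAt P' w‖) * ‖formsAt Q.1 w‖) := by
        gcongr
        refine (norm_add_le _ _).trans_eq ?_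
        rw [norm_smul, norm_smul, Real.norm_of_nonneg ha.le, Real.norm_of_nonneg hb.le]
    _ = a * (r * (‖formsAt P w‖ * ‖formsAt Q.1 w‖)) +
          b * (r * (‖formsAt P' w‖ * ‖formsAt Q.1 w‖)) := by ring
    _ < _ := by
        gcongr
        exacts [hP w hw, hP' w hw]

theorem exists_eventually_mem_approximants (q₀ : rat n m × Set.Ioc (0 : ℝ) 1) :
    ∃ P, ∀ᶠ q : rat n m × Set.Ioc (0 : ℝ) 1 in 𝓝 q₀, P ∈ approximants n q.1.1 (1 - q.2.1) := by
  obtain ⟨P, hP⟩ : q₀.1.1 ∈ Set.range (loopMap n m) := by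
    rw [range_loopMap]
    exact q₀.1.2
  have hlt : (1 - q₀.2.1) ^ 2 < 1 := by nlinarith [q₀.2.2.1, q₀.2.2.2]
  refine ⟨P.1, ?_⟩
  filter_upwards [eventually_lt_inner_veronese (c := fun q => (1 - q.2.1) ^ 2)
    (f := fun q => q.1.1) (by fun_prop) (by fun_prop) hlt] with q hq
  exact ⟨P.2, fun ℓ => by simpa only [← hP] using hq ℓ⟩

theorem exists_continuous_mem_approximants (n m : ℕ) [NeZero n] [NeZero m] :
    ∃ g : C(rat n m × Set.Ioc (0 : ℝ) 1, Fin (m + 1) → Fin n → ℝ),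
      ∀ q, g q ∈ approximants n q.1.1 (1 - q.2.1) := by
  have : TopologicalSpace.MetrizableSpace (rat n m) :=
    (isEmbedding_veronese_comp.comp .subtypeVal).metrizableSpace
  let _ := TopologicalSpace.metrizableSpaceMetric (rat n m × Set.Ioc (0 : ℝ) 1)
  exact exists_continuous_forall_mem_convex_of_local_const
    (fun q => convex_approximants q.1.2 (sub_nonneg.2 q.2.2.2)) exists_eventually_mem_approximants

end Approximation

section HomotopyEquivalence

theorem continuous_of_dist_le {Y E : Type*} [TopologicalSpace Y] [MetricSpace E] {H : I × Y → E}
    {b : Y → E} {ω : ℝ → ℝ} (hb : Continuous b) (hω : Continuous ω) (hω0 : ω 0 = 0)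
    (hH : ContinuousOn H {q | 0 < q.1}) (hdist : ∀ q, dist (H q) (b q.2) ≤ ω q.1) :
    Continuous H := by
  refine continuous_iff_continuousAt.2 fun q₀ => ?_
  rcases unitInterval.nonneg'.eq_or_lt (b := q₀.1) with h0 | hpos
  · have hlimit : Tendsto (fun q : I × Y => ω q.1) (𝓝 q₀) (𝓝 0) := by
      have hcontinuous : Continuous fun q : I × Y => ω q.1 := by fun_prop
      simpa [← h0, hω0] using hcontinuous.tendsto q₀
    have hstart : H q₀ = b q₀.2 := dist_le_zero.1 ((hdist q₀).trans_eq (by simp [← h0, hω0]))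
    rw [ContinuousAt, hstart]
    refine ((hb.comp continuous_snd).tendsto q₀).congr_dist ?_
    exact squeeze_zero (fun _ => dist_nonneg) (fun q => (dist_comm _ _).trans_le (hdist q)) hlimit
  · exact hH.continuousAt ((isOpen_lt continuous_const continuous_fst).mem_nhds hpos)

theorem homotopic_id_of_dist_le {Y E : Type*} [TopologicalSpace Y] [MetricSpace E] {Φ : Y → E}
    (hΦ : IsEmbedding Φ) {ω : ℝ → ℝ} (hω : Continuous ω) (hω0 : ω 0 = 0)
    (G : C(Y × Set.Ioc (0 : ℝ) 1, Y)) (hG : ∀ q, dist (Φ (G q)) (Φ q.1) ≤ ω q.2) :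
    (ContinuousMap.id Y).Homotopic
      (G.comp (.prodMk (.id Y) (.const Y ⟨1, one_pos, le_rfl⟩))) := by
  classical
  let H (q : I × Y) : Y :=
    if h : 0 < (q.1 : ℝ) then G (q.2, ⟨q.1, h, q.1.2.2⟩) else q.2
  have hH (q : I × Y) (h : 0 < (q.1 : ℝ)) : H q = G (q.2, ⟨q.1, h, q.1.2.2⟩) := dif_pos h
  have hcontinuousOn : ContinuousOn (Φ ∘ H) {q | 0 < q.1} := by
    rw [continuousOn_iff_continuous_domRestrict]
    refine (hΦ.continuous.comp (G.continuous.comp (g := G)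
      (f := fun q : {q : I × Y | 0 < q.1} => (q.1.2, ⟨q.1.1, q.2, q.1.1.2.2⟩)) ?_)).congr
        fun q => ?_
    · exact (continuous_snd.comp continuous_subtype_val).prodMk
        (Continuous.subtype_mk (by fun_prop) _)
    · exact congrArg Φ (hH q.1 q.2).symm
  have hcontinuous : Continuous H := by
    rw [hΦ.isInducing.continuous_iff]
    refine continuous_of_dist_le hΦ.continuous hω hω0 hcontinuousOn fun q => ?_
    by_cases h : 0 < (q.1 : ℝ)
    · simpa only [Function.comp_apply, hH q h] using hG (q.2, ⟨q.1, h, q.1.2.2⟩)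
    · have h0 : (q.1 : ℝ) = 0 := le_antisymm (not_lt.1 h) q.1.2.1
      rw [Function.comp_apply, show H q = q.2 from dif_neg h, dist_self, h0, hω0]
  exact ⟨⟨⟨H, hcontinuous⟩, fun _ => dif_neg (lt_irrefl _), fun y => hH (1, y) one_pos⟩⟩

variable {m n : ℕ} [NeZero n] [NeZero m]

/-- The map from tuples of monic polynomials to the space of rational loops. -/
noncomputable def loopRat (n m : ℕ) [NeZero n] [NeZero m] : C(monicTuple n m, rat n m) where
  toFun P := ⟨loopMap n m P, loopMap_mem_rat P⟩

theorem surjective_loopRat : Function.Surjective (loopRat n m) := by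
  rintro ⟨f, hf⟩
  rw [← range_loopMap] at hf
  exact hf.imp fun _ => Subtype.ext

theorem homotopic_id_loopRat_comp {g : C(rat n m × Set.Ioc (0 : ℝ) 1, monicTuple n m)}
    (hg : ∀ q, (g q).1 ∈ approximants n q.1.1 (1 - q.2.1)) :
    (ContinuousMap.id (rat n m)).Homotopic
      (((loopRat n m).comp g).comp (.prodMk (.id _) (.const _ ⟨1, one_pos, le_rfl⟩))) := by
  refine homotopic_id_of_dist_le (isEmbedding_veronese_comp.comp .subtypeVal)
    (ω := fun s => 2 * √s) (by fun_prop) (by simp) _ fun q => ?_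
  exact (ContinuousMap.dist_le (by positivity)).2 (dist_veronese_loopMap_le q.2.2.1.le (hg q))

theorem homotopic_comp_loopRat_id {k : C(rat n m, monicTuple n m)}
    (hk : ∀ f, (k f).1 ∈ approximants n f.1 0) :
    (k.comp (loopRat n m)).Homotopic (.id (monicTuple n m)) := by
  have hpos (P : monicTuple n m) (w) (hw : w ≠ 0) :
      0 < inner ℝ (formsAt (k (loopRat n m P)).1 w) (formsAt P.1 w) := by
    simpa using (mem_approximants_loopMap_iff le_rfl).1 (hk (loopRat n m P)) w hw
  have hmem (q : I × monicTuple n m) :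
      (1 - (q.1 : ℝ)) • (k (loopRat n m q.2)).1 + (q.1 : ℝ) • q.2.1 ∈ monicTuple n m := by
    refine mem_monicTuple_of_inner_pos (Q := q.2.1) fun w hw => ?_
    rw [formsAt_convexComb _ _ (sub_add_cancel _ _), inner_add_left, real_inner_smul_left,
      real_inner_smul_left]
    exact convex_Ioi (0 : ℝ) (hpos q.2 w hw) (real_inner_self_pos.2 (q.2.2 w hw))
      (sub_nonneg.2 q.1.2.2) q.1.2.1 (sub_add_cancel _ _)
  exact ⟨⟨⟨fun q => ⟨_, hmem q⟩, by fun_prop⟩, fun P => Subtype.ext (by simp), fun P =>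
    Subtype.ext (by simp)⟩⟩

theorem exists_homotopyEquiv_toFun_eq_loopRat (n m : ℕ) [NeZero n] [NeZero m] :
    ∃ e : ContinuousMap.HomotopyEquiv (monicTuple n m) (rat n m), e.toFun = loopRat n m := by
  obtain ⟨g, hg⟩ := exists_continuous_mem_approximants n m
  let g' : C(rat n m × Set.Ioc (0 : ℝ) 1, monicTuple n m) :=
    ⟨fun q => ⟨g q, (hg q).choose⟩, by fun_prop⟩
  let k : C(rat n m, monicTuple n m) := g'.comp (.prodMk (.id _) (.const _ ⟨1, one_pos, le_rfl⟩))
  have hk (f : rat n m) : (k f).1 ∈ approximants n f.1 0 := by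
    have happroximant := hg (f, ⟨1, one_pos, le_rfl⟩)
    rwa [sub_self] at happroximant
  exact ⟨⟨loopRat n m, k, homotopic_comp_loopRat_id hk,
    (homotopic_id_loopRat_comp (g := g') hg).symm⟩, rfl⟩

theorem bijective_map_loopRat (P : monicTuple n m) :
    Function.Bijective (FundamentalGroup.map (loopRat n m) P) := by
  obtain ⟨e, he⟩ := exists_homotopyEquiv_toFun_eq_loopRat n m
  rw [← he]
  exact bijective_fundamentalGroupMap_homotopyEquiv e P

end HomotopyEquivalence

/-! ### Rational loops in the projective plane -/

section Plane

variable {n k : ℕ}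

/-- The complex polynomial `(P 1 - P 0) + i (P 2 - P 0)` attached to a triple of monic real
polynomials. -/
def companion (P : Fin 3 → Fin n → ℝ) : Fin n → ℂ :=
  (fun i => ((P 1 - P 0) i : ℂ)) + Complex.I • fun i => ((P 2 - P 0) i : ℂ)

theorem lowForm_sub (a b : Fin n → ℝ) (u v : ℝ) :
    lowForm (a - b) u v = monicForm a u v - monicForm b u v := by
  rw [monicForm, monicForm, add_sub_add_left_eq_sub, eq_sub_iff_add_eq, ← lowForm_add,
    sub_add_cancel]

theorem lowForm_companion (P : Fin 3 → Fin n → ℝ) (u v : ℝ) :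
    lowForm (companion P) u v = ((monicForm (P 1) u v - monicForm (P 0) u v : ℝ) : ℂ) +
      Complex.I * ((monicForm (P 2) u v - monicForm (P 0) u v : ℝ) : ℂ) := by
  rw [companion, lowForm_add, lowForm_smul, lowForm_ofReal, lowForm_ofReal, lowForm_sub,
    lowForm_sub, smul_eq_mul]

/-- A triple of monic real polynomials amounts to its first member and its companion. -/
def companionHomeomorph (n : ℕ) : (Fin 3 → Fin n → ℝ) ≃ₜ (Fin n → ℝ) × (Fin n → ℂ) where
  toFun P := (P 0, companion P)
  invFun x := ![x.1, x.1 + fun i => (x.2 i).re, x.1 + fun i => (x.2 i).im]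
  left_inv P := by
    ext i j
    fin_cases i <;> simp [companion]
  right_inv x := by
    refine Prod.ext rfl (_root_.funext fun i => Complex.ext ?_ ?_) <;> simp [companion]
  continuous_toFun := by
    unfold companion
    fun_prop
  continuous_invFun := continuous_pi fun i => by
    fin_cases i <;> dsimp <;> fun_prop

theorem mem_monicTuple_iff_companionHomeomorph_mem {P : Fin 3 → Fin n → ℝ} :
    P ∈ monicTuple n 2 ↔ companionHomeomorph n P ∈ ratTuple n := by
  refine mem_monicTuple_iff.trans (forall_congr' fun x => ?_)
  have hzero : formsAt P !₂[x, 1] = 0 ↔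
      monicForm (P 0) x 1 = 0 ∧ lowForm (companion P) x 1 = 0 := by
    have hcoordinates : formsAt P !₂[x, 1] = 0 ↔ ∀ i, monicForm (P i) x 1 = 0 := by
      rw [PiLp.ext_iff]
      rfl
    rw [hcoordinates, Fin.forall_fin_succ, Fin.forall_fin_two]
    refine and_congr_right fun h0 => ?_
    simp [lowForm_companion, h0, Complex.ext_iff]
  rw [Ne, hzero, not_and]
  rfl

/-- Triples of monic polynomials without common real zeros, in complex notation. -/
noncomputable def monicTupleHomeomorph (n : ℕ) : monicTuple n 2 ≃ₜ ratTuple n :=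
  (companionHomeomorph n).subtype fun _ => mem_monicTuple_iff_companionHomeomorph_mem

theorem crossingCircle_mulTuple (j : ℕ) (P : monicTuple k 2) :
    crossingCircle (k + 2 * j) (monicTupleHomeomorph _ (mulTuple j P)) =
      crossingCircle k (monicTupleHomeomorph _ P) := by
  refine congrArg Real.Angle.toCircle
    (crossingAngle_eq_of_pos_mul (q := fun t => (t ^ 2 + 1) ^ j) (fun t => by positivity)
      (fun t => (monicForm_mulCoef j (P.1 0) t).trans (mul_comm _ _)) fun t => ?_)
  change lowForm (companion fun i => mulCoef j (P.1 i)) t 1 = _ * lowForm (companion P.1) t 1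
  simp only [lowForm_companion, monicForm_mulCoef]
  push_cast
  ring

variable [NeZero k]

theorem bijective_map_crossingCircle_comp (P : monicTuple k 2) :
    Function.Bijective (FundamentalGroup.map
      ((crossingCircle k).comp (monicTupleHomeomorph k : C(monicTuple k 2, ratTuple k))) P) := by
  rw [fundamentalGroupMap_comp, MonoidHom.coe_comp]
  exact (bijective_map_crossingCircle _).comp
    (bijective_fundamentalGroupMap_homotopyEquiv (monicTupleHomeomorph k).toHomotopyEquiv P)

theorem bijective_map_mulTuple (j : ℕ) (P : monicTuple k 2) :
    Function.Bijective (FundamentalGroup.map (mulTuple (m := 2) j) P) := by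
  have : NeZero (k + 2 * j) := ⟨(NeZero.pos k).trans_le (k.le_add_right _) |>.ne'⟩
  have hcomp : ((crossingCircle (k + 2 * j)).comp (monicTupleHomeomorph (k + 2 * j) :
      C(monicTuple (k + 2 * j) 2, ratTuple (k + 2 * j)))).comp (mulTuple j) =
        (crossingCircle k).comp (monicTupleHomeomorph k : C(monicTuple k 2, ratTuple k)) :=
    ContinuousMap.ext (crossingCircle_mulTuple j)
  have hbijective := bijective_map_crossingCircle_comp P
  rw [← hcomp, fundamentalGroupMap_comp, MonoidHom.coe_comp] at hbijective
  exact (Function.Bijective.of_comp_iff' (bijective_map_crossingCircle_comp _) _).1 hbijective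

instance pathConnectedSpace_rat : PathConnectedSpace (rat k 2) :=
  (surjective_loopRat.comp (monicTupleHomeomorph k).symm.surjective).pathConnectedSpace
    ((loopRat k 2).continuous.comp (monicTupleHomeomorph k).symm.continuous)

theorem nonempty_fundamentalGroup_rat_mulEquiv (f : rat k 2) :
    Nonempty (FundamentalGroup (rat k 2) f ≃* Multiplicative ℤ) := by
  obtain ⟨P, rfl⟩ := surjective_loopRat f
  obtain ⟨i⟩ := nonempty_fundamentalGroup_circle_mulEquiv
    (crossingCircle k (monicTupleHomeomorph k P))
  exact ⟨((MulEquiv.ofBijective _ (bijective_map_loopRat P)).symm.trans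
    (MulEquiv.ofBijective _ (bijective_map_crossingCircle_comp P))).trans i⟩

theorem bijective_map_ratInclusion {j : ℕ} (h : rat k 2 ⊆ rat (k + 2 * j) 2) (f : rat k 2) :
    Function.Bijective (FundamentalGroup.map (ratInclusion h) f) := by
  have : NeZero (k + 2 * j) := ⟨(NeZero.pos k).trans_le (k.le_add_right _) |>.ne'⟩
  obtain ⟨P, rfl⟩ := surjective_loopRat f
  have hcomp : (ratInclusion h).comp (loopRat k 2) = (loopRat (k + 2 * j) 2).comp (mulTuple j) :=
    ContinuousMap.ext fun Q => Subtype.ext (loopMap_mulTuple j Q).symm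
  have hbijective : Function.Bijective
      (FundamentalGroup.map ((loopRat (k + 2 * j) 2).comp (mulTuple j)) P) := by
    rw [fundamentalGroupMap_comp, MonoidHom.coe_comp]
    exact (bijective_map_loopRat _).comp (bijective_map_mulTuple j P)
  rw [← hcomp, fundamentalGroupMap_comp, MonoidHom.coe_comp] at hbijective
  exact (Function.Bijective.of_comp_iff _ (bijective_map_loopRat P)).1 hbijective

theorem exists_bijective_map_ratInclusion {j : ℕ} (hn : n = k + 2 * j) :
    ∃ h : rat k 2 ⊆ rat n 2, ∀ f : rat k 2,
      Function.Bijective (FundamentalGroup.map (ratInclusion h) f) := by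
  subst hn
  exact ⟨rat_subset_rat_add_two_mul j, bijective_map_ratInclusion _⟩

end Plane

end RationalLoops

theorem mainTheorem6 (n : ℕ) (hn : 0 < n) :
    PathConnectedSpace (RationalLoops.rat n 2) ∧
    (∀ f : RationalLoops.rat n 2,
      Nonempty (FundamentalGroup (RationalLoops.rat n 2) f ≃* Multiplicative ℤ)) ∧
    (Odd n → ∃ h : RationalLoops.rat 1 2 ⊆ RationalLoops.rat n 2,
      ∀ f : RationalLoops.rat 1 2,
        Function.Bijective (FundamentalGroup.map (RationalLoops.ratInclusion h) f)) ∧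
    (Even n → ∃ h : RationalLoops.rat 2 2 ⊆ RationalLoops.rat n 2,
      ∀ f : RationalLoops.rat 2 2,
        Function.Bijective (FundamentalGroup.map (RationalLoops.ratInclusion h) f)) := by
  have : NeZero n := ⟨hn.ne'⟩
  refine ⟨RationalLoops.pathConnectedSpace_rat,
    RationalLoops.nonempty_fundamentalGroup_rat_mulEquiv, fun ⟨j, hj⟩ => ?_, fun ⟨j, hj⟩ => ?_⟩
  · exact RationalLoops.exists_bijective_map_ratInclusion (j := j) (by omega)
  · exact RationalLoops.exists_bijective_map_ratInclusion (j := j - 1) (by omega)
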